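/- Let $d\ge 1$, let $K=\prod_{j=1}^d[a_j,b_j]\subset\mathbb R^d$ be a compact interval, $x_0\in K$, $\|\cdot\|$ the Euclidean norm and $B(x_0,r)=\{z:\|z-x_0\|\le r\}$. On a probability space, let $(g_n)_{n\ge1}$ and $(W_n)_{n\ge1}$ be independent sequences such that the $g_n$ are independent symmetric complex random variables that are sub-Gaussian with parameter $1$, i.e. $\mathbb E\,e^{\Re(\bar z g_n)}\le e^{|z|^2/2}$ for all $z\in\mathbb C$, and the $W_n$ are complex-valued continuous random fields on $K$ with, for every $x\in K$, $\sum_{n}|W_n(x)|^2<\infty$ almost surely. Put $$S_N(x)=\sum_{n=1}^N W_n(x)g_n,\quad S(x)=\lim_{N\to\infty}S_N(x),\quad R_N=S-S_N,\quad r_N(x,y)=\Big(\sum_{n=N+1}^{\infty}|W_n(x)-W_n(y)|^2\Big)^{1/2}\in[0,\infty].$$ Let $\rho$ be a quasi-metric on $\mathbb R^d$, i.e. a continuous function $\rho:\mathbb R^d\times\mathbb R^d\to[0,\infty)$ with $\rho(x,y)=0$ iff $x=y$, $\rho(x,y)=\rho(y,x)$, and $\rho(x,z)\le\kappa(\rho(x,y)+\rho(y,z))$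 for some constant $\kappa\ge1$. Assume that there are $0<\underline H\le\overline H\le1$ and $c_1,c_2\in(0,\infty)$ with $c_1\|x-y\|^{\overline H}\le\rho(x,y)\le c_2\|x-y\|^{\underline H}$ whenever $\|x-y\|\le1$. Let $\gamma>0$, $\beta\in(0,1]$, $\eta\in\mathbb R$ be random variables and $(b(N))_{N\ge0}$ a positive random sequence such that, almost surely, $$r_N(x,y)\le b(N)\,\rho(x,y)^{\beta}\,|\log\rho(x,y)|^{\eta}\qquad\text{for all }N\ge0\text{ and all }x,y\in B(x_0,\gamma)\cap K .$$ Here $h^{\beta}|\log h|^{\eta}$ takes its values in $[0,\infty]$: it is $0$ at $h=0$, and at $h=1$ it is $0$, $1$ or $\infty$ according to whether $\eta>0$, $\eta=0$ or $\eta<0$; the same convention holds with $\eta+1/2$ in place of $\eta$. 1. Almost surely there exist $\gamma^*\in(0,\gamma)$ and $C\in(0,\infty)$ such that $S(x)$ converges for all $x\in B(x_0,\gamma^*)\cap K$ and $$|R_N(x)-R_N(y)|\le C\,b(N)\sqrt{\log(N+2)}\;\rho(x,y)^{\beta}\,|\log\rho(x,y)|^{\eta+1/2}$$ for all $N\ge0$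 and all $x,y\in B(x_0,\gamma^*)\cap K$. 2. If, moreover, almost surely $|R_N(x_0)|\le b(N)\sqrt{\log(N+2)}$ for all $N\ge0$, then almost surely there exist $\gamma^*\in(0,\gamma)$ and $C\in(0,\infty)$ such that $S(x)$ converges for all $x\in B(x_0,\gamma^*)\cap K$ and $$|R_N(x)|\le C\,b(N)\sqrt{\log(N+2)}\qquad\text{for all }N\ge0\text{ and all }x\in B(x_0,\gamma^*)\cap K .$$ -/

import Mathlib

open MeasureTheory ProbabilityTheory Filter Topology
open scoped ENNReal NNReal

noncomputable section

namespace CondSubGaussian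

/-- The space `ℝ^d` with the Euclidean norm. -/
abbrev Space (d : ℕ) : Type := EuclideanSpace ℝ (Fin d)

/-- The compact `d`-dimensional interval `K = ∏ j, [lo j, hi j]`. -/
def box {d : ℕ} (lo hi : Fin d → ℝ) : Set (Space d) :=
  {x | ∀ j, lo j ≤ x j ∧ x j ≤ hi j}

/-- A complex random variable `Z` is sub-Gaussian with parameter `s`:
`E (exp (Re (conj z * Z))) ≤ exp (s ^ 2 * |z| ^ 2 / 2)` for every complex `z`
(in particular these expectations are finite). -/
def IsSubGaussian {Ω : Type*} [MeasurableSpace Ω] (P : Measure Ω) (Z : Ω → ℂ) (s : ℝ≥0) : Prop :=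
  ∀ z : ℂ, Integrable (fun ω => Real.exp ((starRingEnd ℂ z * Z ω).re)) P ∧
    ∫ ω, Real.exp ((starRingEnd ℂ z * Z ω).re) ∂P ≤ Real.exp ((s : ℝ) ^ 2 * ‖z‖ ^ 2 / 2)

/-- A random variable is symmetric if `-Z` and `Z` have the same law. -/
def IsSymmetric {Ω : Type*} [MeasurableSpace Ω] (P : Measure Ω) (Z : Ω → ℂ) : Prop :=
  P.map (fun ω => -Z ω) = P.map Z

/-- Quasi-metrics on `ℝ^d`: continuous, nonnegative, faithful, symmetric functions that satisfy
a quasi-triangle inequality. -/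
structure IsQuasiMetric {d : ℕ} (ρ : Space d → Space d → ℝ) : Prop where
  continuous : Continuous (fun p : Space d × Space d => ρ p.1 p.2)
  nonneg : ∀ x y, 0 ≤ ρ x y
  faithful : ∀ x y, ρ x y = 0 ↔ x = y
  symm : ∀ x y, ρ x y = ρ y x
  quasi_triangle : ∃ κ : ℝ, 1 ≤ κ ∧ ∀ x y z, ρ x z ≤ κ * (ρ x y + ρ y z)

/-- Local comparison of `ρ` with powers of the Euclidean distance: there are
`0 < H₁ ≤ H₂ ≤ 1` and positive constants `c₁`, `c₂` with
`c₁ ‖x - y‖ ^ H₂ ≤ ρ x y ≤ c₂ ‖x - y‖ ^ H₁` whenever `‖x - y‖ ≤ 1`. -/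
def LocallyHolderComparable {d : ℕ} (ρ : Space d → Space d → ℝ) : Prop :=
  ∃ H₁ H₂ c₁ c₂ : ℝ, 0 < H₁ ∧ H₁ ≤ H₂ ∧ H₂ ≤ 1 ∧ 0 < c₁ ∧ 0 < c₂ ∧
    ∀ x y : Space d, ‖x - y‖ ≤ 1 → c₁ * ‖x - y‖ ^ H₂ ≤ ρ x y ∧ ρ x y ≤ c₂ * ‖x - y‖ ^ H₁

/-- The modulus `h ^ β * |log h| ^ η`, with values in `[0, ∞]`. For `β > 0` its value at `h = 0`
is `0`, whatever `η` is. At `h = 1` its value is `0 ^ η`, that is `0` if `η > 0`, `1` if `η = 0`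
and `∞` if `η < 0`. -/
def logModulus (β η h : ℝ) : ℝ≥0∞ :=
  ENNReal.ofReal h ^ β * ENNReal.ofReal |Real.log h| ^ η

section Series

variable {Ω : Type*} {d : ℕ} {lo hi : Fin d → ℝ}

/-- The series is indexed from `0`: `W n`, `g n` here are the `(n+1)`-st field and the `(n+1)`-st
random variable of the sequences. The partial sum of the first `N` terms, for the outcome `ω`, at
the point `x`. -/
def partialSum (W : ℕ → Ω → box lo hi → ℂ) (g : ℕ → Ω → ℂ) (N : ℕ) (ω : Ω) (x : box lo hi) : ℂ :=
  ∑ n ∈ Finset.range N, W n ω x * g n ω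

/-- Convergence, for the outcome `ω`, of the series at the point `x`. -/
def Converges (W : ℕ → Ω → box lo hi → ℂ) (g : ℕ → Ω → ℂ) (ω : Ω) (x : box lo hi) : Prop :=
  ∃ l : ℂ, Tendsto (fun N => partialSum W g N ω x) atTop (𝓝 l)

/-- The limit field `S`: the limit of the partial sums (meaningful where they converge). -/
def limitField (W : ℕ → Ω → box lo hi → ℂ) (g : ℕ → Ω → ℂ) (ω : Ω) (x : box lo hi) : ℂ :=
  limUnder atTop (fun N => partialSum W g N ω x)

/-- The rest `R_N = S - S_N`. -/
def rest (W : ℕ → Ω → box lo hi → ℂ) (g : ℕ → Ω → ℂ) (N : ℕ) (ω : Ω) (x : box lo hi) : ℂ :=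
  limitField W g ω x - partialSum W g N ω x

/-- The conditional parameter `r_N(x, y) = (∑_{n > N} |W_n(x) - W_n(y)| ^ 2) ^ (1/2)` of
`R_N(x) - R_N(y)`, with values in `[0, ∞]`. -/
def tailParam (W : ℕ → Ω → box lo hi → ℂ) (N : ℕ) (ω : Ω) (x y : box lo hi) : ℝ≥0∞ :=
  (∑' n : ℕ, ‖W (N + n) ω x - W (N + n) ω y‖ₑ ^ 2) ^ (1 / 2 : ℝ)

/-- The standing assumption on the series: `(g_n)` and `(W_n)` are independent sequences, the `g_n`
are independent symmetric sub-Gaussian complex random variables with parameter `1`, and the `W_n`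
are continuous complex random fields on the box that are square-summable almost surely at each
point. -/
structure IsCondSubGaussianSeries [MeasurableSpace Ω] (P : Measure Ω)
    (W : ℕ → Ω → box lo hi → ℂ) (g : ℕ → Ω → ℂ) : Prop where
  measurable_g : ∀ n, Measurable (g n)
  measurable_W : ∀ n x, Measurable (fun ω => W n ω x)
  indep_sequences : IndepFun (fun ω (n : ℕ) => g n ω) (fun ω (n : ℕ) (x : box lo hi) => W n ω x) P
  indep_g : iIndepFun g P
  symmetric_g : ∀ n, IsSymmetric P (g n)
  subGaussian_g : ∀ n, IsSubGaussian P (g n) 1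
  continuous_W : ∀ᵐ ω ∂P, ∀ n, Continuous (W n ω)
  summable_W : ∀ x, ∀ᵐ ω ∂P, Summable (fun n => ‖W n ω x‖ ^ 2)

/-- The local assumption at `x₀` on the tails, with random variables `γ > 0`, `β ∈ (0, 1]`,
`η ∈ ℝ` and a positive random sequence `b`: almost surely,
`r_N(x, y) ≤ b(N) ρ(x, y) ^ β |log ρ(x, y)| ^ η` for all `N` and all `x`, `y` of the box in
the closed ball with centre `x₀` and radius `γ`. -/
structure IsTailBound [MeasurableSpace Ω] (P : Measure Ω) (W : ℕ → Ω → box lo hi → ℂ)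
    (x₀ : box lo hi) (ρ : Space d → Space d → ℝ) (γ β η : Ω → ℝ) (b : ℕ → Ω → ℝ) : Prop where
  measurable_γ : Measurable γ
  measurable_β : Measurable β
  measurable_η : Measurable η
  measurable_b : ∀ N, Measurable (b N)
  γ_pos : ∀ᵐ ω ∂P, 0 < γ ω
  β_mem : ∀ᵐ ω ∂P, 0 < β ω ∧ β ω ≤ 1
  b_pos : ∀ᵐ ω ∂P, ∀ N, 0 < b N ω
  bound : ∀ᵐ ω ∂P, ∀ N, ∀ x y : box lo hi,
    ‖(x : Space d) - x₀‖ ≤ γ ω → ‖(y : Space d) - x₀‖ ≤ γ ω →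
      tailParam W N ω x y ≤ ENNReal.ofReal (b N ω) * logModulus (β ω) (η ω) (ρ x y)

end Series

end CondSubGaussian

end

/-! Since `W` and `g` are independent, `W` can be frozen: every increment of a partial sum becomes a
series of independent symmetric sub-Gaussian variables with deterministic coefficients. Symmetry
makes the exponentials of its real projections submartingales, so Doob's inequality gives a Gaussian
tail for all partial sums at once, scaled by the `ℓ²` norm of the coefficients
(`measure_exists_lt_enorm_sum_le`).

Points of finite nets at scales `exp (-k)` carry weights of order `k`. A union bound over pairs of
net points and over `N` gives one random constant `A` with increments of the `N`-th tail at most `A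
* √(weights + log (N + 2))` times the conditional parameter (`ae_exists_forall_enorm_sum_le`,
transferred to random `W` by `ae_mem_of_indepFun`). From there on the outcome is fixed.

Chaining (`exists_chaining`) extends the bound from net points to all points near `x₀`. At scale `k`
the weights contribute `√k`, which is `|log ρ| ^ (1/2)`: this is the extra `1/2` in the exponent,
while `log (N + 2)` gives the other factor. The chaining is done on finite blocks of the series,
which are continuous, with bounds uniform in the block length. This yields convergence off the net,
and then the bounds for the rests in the limit (`exists_rest_bound`). -/

namespace CondSubGaussian

/-! ### Doob's maximal inequality for exponentials of independent sums -/

section MaximalInequality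

variable {Ω : Type*} [MeasurableSpace Ω] {P : Measure Ω} [IsProbabilityMeasure P]

lemma integrable_prod_range {Y : ℕ → Ω → ℝ} (hm : ∀ n, Measurable (Y n)) (hind : iIndepFun Y P)
    (hint : ∀ n, Integrable (Y n) P) (n : ℕ) :
    Integrable (∏ i ∈ Finset.range n, Y i) P ∧
      ∫ ω, (∏ i ∈ Finset.range n, Y i) ω ∂P = ∏ i ∈ Finset.range n, ∫ ω, Y i ω ∂P := by
  induction n with
  | zero => simp [Pi.one_def]
  | succ n ih =>
    have hi := hind.indepFun_prod_range_succ hm n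
    rw [Finset.prod_range_succ, Finset.prod_range_succ]
    refine ⟨hi.integrable_mul ih.1 (hint n), ?_⟩
    rw [hi.integral_mul_eq_mul_integral ih.1.aestronglyMeasurable (hint n).aestronglyMeasurable,
      ih.2]

/-- Partial products of independent nonnegative variables with means at least `1` form a
submartingale. -/
lemma submartingale_prod {Y : ℕ → Ω → ℝ} (hm : ∀ n, StronglyMeasurable (Y n))
    (hind : iIndepFun Y P) (hint : ∀ n, Integrable (Y n) P) (h0 : ∀ n ω, 0 ≤ Y n ω)
    (h1 : ∀ n, 1 ≤ ∫ ω, Y n ω ∂P) :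
    Submartingale (fun n => ∏ i ∈ Finset.range (n + 1), Y i) (Filtration.natural Y hm) P := by
  have hI := fun n => (integrable_prod_range (fun n => (hm n).measurable) hind hint n).1
  have hadp : StronglyAdapted (Filtration.natural Y hm)
      (fun n => ∏ i ∈ Finset.range (n + 1), Y i) := by
    intro n
    refine Finset.stronglyMeasurable_prod _ fun i hi => ?_
    exact (Filtration.stronglyAdapted_natural hm i).mono
      ((Filtration.natural Y hm).mono (Nat.lt_succ_iff.mp (Finset.mem_range.mp hi)))
  refine submartingale_nat hadp (fun n => hI _) fun n => ?_
  have hsucc : (∏ i ∈ Finset.range (n + 1 + 1), Y i)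
      = (∏ i ∈ Finset.range (n + 1), Y i) * Y (n + 1) := Finset.prod_range_succ _ _
  have hpull := condExp_mul_of_stronglyMeasurable_left (hadp n) (hsucc ▸ hI (n + 1 + 1))
    (hint (n + 1))
  have hconst := hind.condExp_natural_ae_eq_of_lt hm n.lt_succ_self
  simp only [hsucc]
  filter_upwards [hpull, hconst] with ω h2 h3
  rw [h2, Pi.mul_apply, h3]
  refine le_mul_of_one_le_right ?_ (h1 _)
  rw [Finset.prod_apply]
  exact Finset.prod_nonneg fun i _ => h0 i ω

/-- The exponentials of the partial sums form a nonnegative submartingale, so a running maximum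
costs no more than Markov's inequality at the final time. -/
lemma measure_exists_le_sum_le {X : ℕ → Ω → ℝ} (hm : ∀ n, Measurable (X n))
    (hind : iIndepFun X P) (hint : ∀ n, Integrable (fun ω => Real.exp (X n ω)) P)
    (h1 : ∀ n, 1 ≤ ∫ ω, Real.exp (X n ω) ∂P) (t : ℝ) (n : ℕ) :
    P {ω | ∃ k ≤ n, t ≤ ∑ i ∈ Finset.range (k + 1), X i ω} ≤
      ENNReal.ofReal (Real.exp (-t) *
        ∏ i ∈ Finset.range (n + 1), ∫ ω, Real.exp (X i ω) ∂P) := by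
  set Y : ℕ → Ω → ℝ := fun n ω => Real.exp (X n ω) with hY
  have hYm : ∀ n, Measurable (Y n) := fun n => (hm n).exp
  have hYind : iIndepFun Y P := hind.comp (fun _ => Real.exp) fun _ => Real.measurable_exp
  have hsub := submartingale_prod (fun n => (hYm n).stronglyMeasurable) hYind hint
    (fun n ω => (Real.exp_pos _).le) h1
  have hprod : ∀ k ω, (∏ i ∈ Finset.range (k + 1), Y i) ω
      = Real.exp (∑ i ∈ Finset.range (k + 1), X i ω) := by
    intro k ω
    rw [Finset.prod_apply, Real.exp_sum]
  have hnn : 0 ≤ fun n => ∏ i ∈ Finset.range (n + 1), Y i := by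
    intro k ω
    exact (Real.exp_pos _).le.trans_eq (hprod k ω).symm
  have hmax := maximal_ineq hsub hnn (ε := ⟨Real.exp t, (Real.exp_pos t).le⟩) n
  obtain ⟨hI, hE⟩ := integrable_prod_range hYm hYind hint (n + 1)
  have hset : {ω | ∃ k ≤ n, t ≤ ∑ i ∈ Finset.range (k + 1), X i ω} =
      {ω | ((⟨Real.exp t, (Real.exp_pos t).le⟩ : ℝ≥0) : ℝ) ≤
        (Finset.range (n + 1)).sup' Finset.nonempty_range_add_one
          fun k => (∏ i ∈ Finset.range (k + 1), Y i) ω} := by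
    ext ω
    simp [Finset.le_sup'_iff, hprod]
  rw [hset]
  refine (ENNReal.mul_le_mul_iff_right (a := ENNReal.ofReal (Real.exp t)) ?_ ?_).mp ?_
  · simpa using Real.exp_pos t
  · exact ENNReal.ofReal_ne_top
  rw [← ENNReal.ofReal_mul (Real.exp_pos t).le, ← mul_assoc, ← Real.exp_add, add_neg_cancel,
    Real.exp_zero, one_mul, ← hE]
  have hcoe : ENNReal.ofReal (Real.exp t) =
      ENNReal.ofNNReal ⟨Real.exp t, (Real.exp_pos t).le⟩ :=
    ENNReal.ofReal_eq_coe_nnreal _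
  rw [hcoe]
  refine hmax.trans (ENNReal.ofReal_le_ofReal ?_)
  exact setIntegral_le_integral hI (ae_of_all _ fun ω => hnn n ω)

end MaximalInequality

/-! ### Gaussian tails for series with deterministic coefficients -/

section Tail

variable {Ω : Type*} [MeasurableSpace Ω] {P : Measure Ω} [IsProbabilityMeasure P]

/-- Independent symmetric sub-Gaussian complex random variables with parameter `1`. -/
structure IsSymmSubGaussianSeq (P : Measure Ω) (g : ℕ → Ω → ℂ) : Prop where
  measurable : ∀ n, Measurable (g n)
  indep : iIndepFun g P
  symmetric : ∀ n, IsSymmetric P (g n)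
  subGaussian : ∀ n, IsSubGaussian P (g n) 1

omit [IsProbabilityMeasure P] in
lemma IsSymmSubGaussianSeq.shift {g : ℕ → Ω → ℂ} (hg : IsSymmSubGaussianSeq P g) (N : ℕ) :
    IsSymmSubGaussianSeq P (fun n => g (N + n)) where
  measurable _ := hg.measurable _
  indep := hg.indep.precomp (add_right_injective N)
  symmetric _ := hg.symmetric _
  subGaussian _ := hg.subGaussian _

/-- The `ℓ²` norm of a complex sequence, with values in `[0, ∞]`. -/
noncomputable def l2Norm (a : ℕ → ℂ) : ℝ≥0∞ := (∑' n, ‖a n‖ₑ ^ 2) ^ (1 / 2 : ℝ)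

/-- By symmetry the integral equals that of the hyperbolic cosine, which is at least `1`. This is
the submartingale condition. -/
lemma one_le_integral_exp_re {Z : Ω → ℂ} (hm : Measurable Z) (hs : IsSymmetric P Z)
    (hZ : IsSubGaussian P Z 1) (z : ℂ) :
    1 ≤ ∫ ω, Real.exp ((starRingEnd ℂ z * Z ω).re) ∂P := by
  have hneg : ∫ ω, Real.exp ((starRingEnd ℂ z * -Z ω).re) ∂P
      = ∫ ω, Real.exp ((starRingEnd ℂ z * Z ω).re) ∂P := by
    have hF : Measurable fun w : ℂ => Real.exp ((starRingEnd ℂ z * w).re) := by fun_prop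
    rw [← integral_map (φ := fun ω => -Z ω) (f := fun w : ℂ => Real.exp ((starRingEnd ℂ z * w).re))
      hm.neg.aemeasurable hF.aestronglyMeasurable, hs,
      integral_map hm.aemeasurable hF.aestronglyMeasurable]
  have hint := (hZ z).1
  have hint' : Integrable (fun ω => Real.exp ((starRingEnd ℂ z * -Z ω).re)) P := by
    simpa using (hZ (-z)).1
  have h2 : ∫ _ω, (2 : ℝ) ∂P ≤ ∫ ω, (Real.exp ((starRingEnd ℂ z * Z ω).re)
      + Real.exp ((starRingEnd ℂ z * -Z ω).re)) ∂P := by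
    refine integral_mono (integrable_const _) (hint.add hint') fun ω => ?_
    have := Real.one_le_cosh ((starRingEnd ℂ z * Z ω).re)
    rw [Real.cosh_eq] at this
    simp only [mul_neg, Complex.neg_re]
    linarith
  rw [integral_add hint hint', hneg] at h2
  rw [integral_const, probReal_univ, one_smul] at h2
  linarith

/-- Moving `a i` to the conjugated side turns each term into a projection of `g i` alone, and the
sub-Gaussian exponents add up. -/
lemma measure_exists_le_re_sum_le {g : ℕ → Ω → ℂ} (hg : IsSymmSubGaussianSeq P g) (a : ℕ → ℂ)
    (z : ℂ) (t : ℝ) (n : ℕ) :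
    P {ω | ∃ k ≤ n, t ≤ (starRingEnd ℂ z * ∑ i ∈ Finset.range (k + 1), a i * g i ω).re} ≤
      ENNReal.ofReal (Real.exp (-t + ‖z‖ ^ 2 / 2 * ∑ i ∈ Finset.range (n + 1), ‖a i‖ ^ 2)) := by
  have hconj : ∀ i ω, starRingEnd ℂ z * (a i * g i ω)
      = starRingEnd ℂ (z * starRingEnd ℂ (a i)) * g i ω := by
    intro i ω
    simp [mul_assoc]
  have hF : ∀ i, Measurable fun w : ℂ => (starRingEnd ℂ (z * starRingEnd ℂ (a i)) * w).re := by
    intro i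
    fun_prop
  have key := measure_exists_le_sum_le (P := P)
    (X := fun i ω => (starRingEnd ℂ (z * starRingEnd ℂ (a i)) * g i ω).re)
    (fun i => (hF i).comp (hg.measurable i)) (hg.indep.comp _ hF)
    (fun i => (hg.subGaussian i _).1)
    (fun i => one_le_integral_exp_re (hg.measurable i) (hg.symmetric i) (hg.subGaussian i) _) t n
  simp only [Finset.mul_sum, hconj, Complex.re_sum]
  refine key.trans (ENNReal.ofReal_le_ofReal ?_)
  rw [Real.exp_add, Real.exp_sum]
  refine mul_le_mul_of_nonneg_left ?_ (Real.exp_pos _).le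
  refine Finset.prod_le_prod (fun i _ => integral_nonneg fun ω => (Real.exp_pos _).le)
    fun i _ => ?_
  refine ((hg.subGaussian i _).2).trans (Real.exp_le_exp.mpr (le_of_eq ?_))
  simp
  ring

lemma measure_exists_lt_re_sum_le {g : ℕ → Ω → ℂ} (hg : IsSymmSubGaussianSeq P g) {a : ℕ → ℂ}
    {σ : ℝ} (hσ : 0 < σ) (ha : ∀ n, ∑ i ∈ Finset.range n, ‖a i‖ ^ 2 ≤ σ ^ 2) {s : ℝ} (hs : 0 ≤ s)
    {z : ℂ} (hz : ‖z‖ = 1) :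
    P {ω | ∃ k, s * σ < (starRingEnd ℂ z * ∑ i ∈ Finset.range k, a i * g i ω).re} ≤
      ENNReal.ofReal (Real.exp (-s ^ 2 / 2)) := by
  -- The multiplier `s / σ` is the Chernoff optimum: the exponent becomes `-s ^ 2 + s ^ 2 / 2`. The
  -- sets increase with `n`, so the bound survives the union.
  set S : ℕ → Set Ω := fun n => {ω | ∃ k ≤ n, s ^ 2 ≤ (starRingEnd ℂ (((s / σ : ℝ) : ℂ) * z) *
    ∑ i ∈ Finset.range (k + 1), a i * g i ω).re} with hS
  have hmono : Monotone S := by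
    rintro m n hmn ω ⟨k, hk, h⟩
    exact ⟨k, hk.trans hmn, h⟩
  have hsub : {ω | ∃ k, s * σ < (starRingEnd ℂ z * ∑ i ∈ Finset.range k, a i * g i ω).re} ⊆
      ⋃ n, S n := by
    rintro ω ⟨k, hk⟩
    rcases k with _ | k
    · simp at hk
      nlinarith
    · refine Set.mem_iUnion.mpr ⟨k, k, le_rfl, ?_⟩
      rw [map_mul, Complex.conj_ofReal, mul_assoc, Complex.re_ofReal_mul]
      calc s ^ 2 = s / σ * (s * σ) := by field_simp
        _ ≤ _ := mul_le_mul_of_nonneg_left hk.le (by positivity)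
  refine (measure_mono hsub).trans ?_
  rw [hmono.measure_iUnion]
  refine iSup_le fun n => (measure_exists_le_re_sum_le hg a _ _ n).trans
    (ENNReal.ofReal_le_ofReal (Real.exp_le_exp.mpr ?_))
  rw [norm_mul, hz, mul_one, Complex.norm_real, Real.norm_eq_abs, sq_abs]
  have h1 : (s / σ) ^ 2 / 2 * ∑ i ∈ Finset.range (n + 1), ‖a i‖ ^ 2 ≤ (s / σ) ^ 2 / 2 * σ ^ 2 :=
    mul_le_mul_of_nonneg_left (ha _) (by positivity)
  have h2 : (s / σ) ^ 2 / 2 * σ ^ 2 = s ^ 2 / 2 := by field_simp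
  linarith

lemma l2Norm_eq_zero {a : ℕ → ℂ} (h : l2Norm a = 0) (n : ℕ) : a n = 0 := by
  have h' : ∑' n, ‖a n‖ₑ ^ 2 = 0 := by
    have := h
    rw [l2Norm, ENNReal.rpow_eq_zero_iff_of_pos (by norm_num)] at this
    exact this
  simpa using ENNReal.tsum_eq_zero.mp h' n

lemma sum_sq_le_l2Norm {a : ℕ → ℂ} (h : l2Norm a ≠ ∞) (n : ℕ) :
    ∑ i ∈ Finset.range n, ‖a i‖ ^ 2 ≤ (l2Norm a).toReal ^ 2 := by
  have hsq : l2Norm a ^ 2 = ∑' n, ‖a n‖ₑ ^ 2 := by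
    rw [l2Norm, ← ENNReal.rpow_natCast, ← ENNReal.rpow_mul]
    norm_num
  rw [← ENNReal.toReal_pow, hsq]
  refine ENNReal.ofReal_le_iff_le_toReal (hsq ▸ ENNReal.pow_ne_top h) |>.mp ?_
  rw [ENNReal.ofReal_sum_of_nonneg fun i _ => by positivity]
  refine le_trans (le_of_eq ?_) (ENNReal.sum_le_tsum (Finset.range n))
  refine Finset.sum_congr rfl fun i _ => ?_
  rw [ENNReal.ofReal_pow (norm_nonneg _), ofReal_norm]

/-- A maximal tail inequality for series of independent symmetric sub-Gaussian variables. -/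
lemma measure_exists_lt_enorm_sum_le {g : ℕ → Ω → ℂ} (hg : IsSymmSubGaussianSeq P g) (a : ℕ → ℂ)
    {s : ℝ} (hs : 0 < s) :
    P {ω | ∃ k, ENNReal.ofReal (2 * s) * l2Norm a < ‖∑ i ∈ Finset.range k, a i * g i ω‖ₑ} ≤
      4 * ENNReal.ofReal (Real.exp (-s ^ 2 / 2)) := by
  by_cases htop : l2Norm a = ∞
  · have : ENNReal.ofReal (2 * s) * ∞ = ∞ := ENNReal.mul_top (by simpa using hs)
    simp only [htop, this, not_top_lt, exists_false, Set.ofPred_false, measure_empty, zero_le]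
  by_cases hzero : l2Norm a = 0
  · simp [hzero, l2Norm_eq_zero hzero]
  set σ := (l2Norm a).toReal with hσdef
  have hσ : 0 < σ := ENNReal.toReal_pos hzero htop
  have ha := sum_sq_le_l2Norm htop
  have T := fun z hz => measure_exists_lt_re_sum_le hg hσ ha hs.le (z := z) hz
  -- A modulus above `2 * s * σ` forces the real or the imaginary part above `s * σ` in absolute
  -- value; the four directions `±1`, `±I` account for the factor `4`.
  set E : ℂ → Set Ω := fun z =>
    {ω | ∃ k, s * σ < (starRingEnd ℂ z * ∑ i ∈ Finset.range k, a i * g i ω).re} with hE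
  have hsub : {ω | ∃ k, ENNReal.ofReal (2 * s) * l2Norm a <
      ‖∑ i ∈ Finset.range k, a i * g i ω‖ₑ} ⊆ (E 1 ∪ E (-1)) ∪ (E Complex.I ∪ E (-Complex.I)) := by
    rintro ω ⟨k, hk⟩
    set w := ∑ i ∈ Finset.range k, a i * g i ω with hw
    rw [← ENNReal.ofReal_toReal htop, ← ENNReal.ofReal_mul (by positivity), ← ofReal_norm,
      ENNReal.ofReal_lt_ofReal_iff_of_nonneg (by positivity)] at hk
    have habs : 2 * s * σ < |w.re| + |w.im| := hk.trans_le (Complex.norm_le_abs_re_add_abs_im w)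
    have hcases : s * σ < |w.re| ∨ s * σ < |w.im| := by
      by_contra! h
      linarith [h.1, h.2]
    rcases hcases with h | h <;> rcases lt_abs.mp h with h | h
    · exact Or.inl (Or.inl ⟨k, by rw [← hw]; simpa using h⟩)
    · exact Or.inl (Or.inr ⟨k, by rw [← hw]; simpa using h⟩)
    · exact Or.inr (Or.inl ⟨k, by rw [← hw]; simpa using h⟩)
    · exact Or.inr (Or.inr ⟨k, by rw [← hw]; simpa using h⟩)
  refine (measure_mono hsub).trans ((measure_union_le _ _).trans
    ((add_le_add (measure_union_le _ _) (measure_union_le _ _)).trans ?_))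
  refine (add_le_add (add_le_add (T 1 (by simp)) (T (-1) (by simp)))
    (add_le_add (T Complex.I (by simp)) (T (-Complex.I) (by simp)))).trans (le_of_eq ?_)
  ring

end Tail

/-! ### Simultaneous bounds for countably many series, and convergence -/

section UniformBounds

variable {Ω : Type*} [MeasurableSpace Ω] {P : Measure Ω} [IsProbabilityMeasure P]

/-- With `w = c + log (N + 2)`, the exponent `2 * (m + 1) ^ 2 * w` is at least `m * w + 2 * w`: the
first part gives the geometric factor in `m`, the second one decay that is summable over weights and
over `N`. -/
lemma exp_neg_mul_le {c : ℝ} (hc : 0 ≤ c) (m N : ℕ) :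
    Real.exp (-(2 * ((m : ℝ) + 1) * √(c + Real.log (N + 2))) ^ 2 / 2) ≤
      (1 / 2) ^ m * (Real.exp (-c) * (1 / ((N : ℝ) + 2) ^ 2)) := by
  have hlog : Real.log 2 ≤ Real.log (N + 2) :=
    Real.log_le_log (by norm_num) (by linarith [Nat.cast_nonneg (α := ℝ) N])
  have hlog0 : 0 ≤ Real.log 2 := Real.log_nonneg (by norm_num)
  have hw : 0 ≤ c + Real.log (N + 2) := by linarith
  have e1 : ((1 : ℝ) / 2) ^ m = Real.exp (-(m * Real.log 2)) := by
    rw [Real.exp_neg, Real.exp_nat_mul, Real.exp_log (by norm_num)]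
    simp
  have e2 : 1 / ((N : ℝ) + 2) ^ 2 = Real.exp (-(2 * Real.log (N + 2))) := by
    rw [Real.exp_neg, two_mul, Real.exp_add, Real.exp_log (by positivity)]
    rw [one_div, sq]
  rw [e1, e2, ← Real.exp_add, ← Real.exp_add, Real.exp_le_exp, mul_pow, Real.sq_sqrt hw]
  have hm : (0 : ℝ) ≤ m := Nat.cast_nonneg m
  have h1 : (m + 2) * (c + Real.log (N + 2)) ≤ 2 * (m + 1) ^ 2 * (c + Real.log (N + 2)) :=
    mul_le_mul_of_nonneg_right (by nlinarith) hw
  nlinarith [mul_nonneg hm hc, mul_le_mul_of_nonneg_left hlog hm]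

/-- Countably many series of independent symmetric sub-Gaussian variables are almost surely
bounded, together with all their tails, by their conditional parameters and logarithmic weights. -/
lemma ae_exists_forall_enorm_sum_le {g : ℕ → Ω → ℂ} (hg : IsSymmSubGaussianSeq P g) {ι : Type*}
    [Countable ι] (a : ι → ℕ → ℂ) {c : ι → ℝ} (hc0 : ∀ i, 0 ≤ c i)
    (hc : Summable fun i => Real.exp (-c i)) :
    ∀ᵐ ω ∂P, ∃ A : ℕ, ∀ i N k,
      ‖∑ j ∈ Finset.range k, a i (N + j) * g (N + j) ω‖ₑ ≤
        ENNReal.ofReal (A * √(c i + Real.log ((N : ℝ) + 2))) * l2Norm fun n => a i (N + n) := by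
  set s : ℕ → ι × ℕ → ℝ := fun m p => 2 * ((m : ℝ) + 1) * √(c p.1 + Real.log ((p.2 : ℝ) + 2))
    with hs
  set B : ℕ → ι × ℕ → Set Ω := fun m p => {ω | ∃ k, ENNReal.ofReal (2 * s m p) *
    (l2Norm fun n => a p.1 (p.2 + n)) <
      ‖∑ j ∈ Finset.range k, a p.1 (p.2 + j) * g (p.2 + j) ω‖ₑ} with hB
  set T : ℝ≥0∞ := ∑' p : ι × ℕ,
    ENNReal.ofReal (Real.exp (-c p.1) * (1 / ((p.2 : ℝ) + 2) ^ 2)) with hT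
  have hTtop : T ≠ ∞ := by
    have hN : Summable fun N : ℕ => 1 / ((N : ℝ) + 2) ^ 2 := by
      have := (summable_nat_add_iff 2).mpr (Real.summable_one_div_nat_pow.mpr one_lt_two)
      exact_mod_cast this
    exact (hc.mul_of_nonneg hN (fun i => (Real.exp_pos _).le)
      (fun N => by positivity)).tsum_ofReal_ne_top
  -- The event that level `m` fails for some series and some tail has probability of order `2 ^
  -- (-m)`, so almost surely some level never fails.
  have hBle : ∀ m, P (⋃ p, B m p) ≤ ENNReal.ofReal ((1 / 2) ^ m) * (4 * T) := by
    intro m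
    refine (measure_iUnion_le _).trans ?_
    rw [hT, ← ENNReal.tsum_mul_left, ← ENNReal.tsum_mul_left]
    refine ENNReal.tsum_le_tsum fun p => ?_
    have hpos : 0 < s m p := by
      have : 0 < Real.log ((p.2 : ℝ) + 2) :=
        Real.log_pos (by linarith [Nat.cast_nonneg (α := ℝ) p.2])
      have := hc0 p.1
      positivity
    refine (measure_exists_lt_enorm_sum_le (hg.shift p.2) _ hpos).trans ?_
    rw [mul_left_comm, ← ENNReal.ofReal_mul (by positivity)]
    exact mul_le_mul_right (ENNReal.ofReal_le_ofReal (exp_neg_mul_le (hc0 p.1) m p.2)) _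
  have hnull : P (⋂ m, ⋃ p, B m p) = 0 := by
    have hlim : Tendsto (fun m : ℕ => ENNReal.ofReal ((1 / 2) ^ m) * (4 * T)) atTop (𝓝 0) := by
      have h0 : Tendsto (fun m : ℕ => ENNReal.ofReal ((1 / 2) ^ m)) atTop (𝓝 0) := by
        rw [← ENNReal.ofReal_zero]
        exact ENNReal.tendsto_ofReal
          (tendsto_pow_atTop_nhds_zero_of_lt_one (by norm_num) (by norm_num))
      simpa using ENNReal.Tendsto.mul_const h0
        (Or.inr (ENNReal.mul_ne_top (by norm_num) hTtop))
    exact le_antisymm (ge_of_tendsto' hlim fun m =>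
      (measure_mono (Set.iInter_subset _ m)).trans (hBle m)) zero_le
  filter_upwards [measure_eq_zero_iff_ae_notMem.mp hnull] with ω hω
  simp only [Set.mem_iInter, not_forall, Set.mem_iUnion, not_exists] at hω
  obtain ⟨m, hm⟩ := hω
  refine ⟨4 * (m + 1), fun i N k => ?_⟩
  have := hm (i, N)
  simp only [hB, Set.mem_ofPred_eq, not_exists, not_lt] at this
  refine (this k).trans (le_of_eq ?_)
  congr 2
  simp only [hs]
  push_cast
  ring

lemma tendsto_l2Norm_shift {a : ℕ → ℂ} (ha : l2Norm a ≠ ∞) :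
    Tendsto (fun N => l2Norm fun n => a (N + n)) atTop (𝓝 0) := by
  have h : ∑' n, ‖a n‖ₑ ^ 2 ≠ ∞ := by
    intro h
    rw [l2Norm, h] at ha
    simp at ha
  have h1 := ENNReal.tendsto_sum_nat_add _ h
  have h2 := h1.ennrpow_const (1 / 2 : ℝ)
  simp only [add_comm] at h2
  simpa [l2Norm, ENNReal.zero_rpow_of_pos] using h2

/-- A series of independent symmetric sub-Gaussian variables with square-summable coefficients
converges almost surely. -/
lemma ae_exists_tendsto_sum {g : ℕ → Ω → ℂ} (hg : IsSymmSubGaussianSeq P g) {a : ℕ → ℂ}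
    (ha : l2Norm a ≠ ∞) :
    ∀ᵐ ω ∂P, ∃ l, Tendsto (fun N => ∑ n ∈ Finset.range N, a n * g n ω) atTop (𝓝 l) := by
  have key : ∀ m : ℕ, ∀ᵐ ω ∂P, ∃ N, ∀ k,
      ‖∑ j ∈ Finset.range k, a (N + j) * g (N + j) ω‖ₑ ≤ ENNReal.ofReal (1 / ((m : ℝ) + 1)) := by
    intro m
    have hε : 0 < ENNReal.ofReal (1 / ((m : ℝ) + 1)) := by
      rw [ENNReal.ofReal_pos]
      positivity
    -- For each `s`, the tail norm is small enough from some `N` on for the level-`s` inequality to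
    -- control this event; then `s` tends to infinity.
    have hbound : ∀ s : ℕ, P {ω | ¬ ∃ N, ∀ k,
        ‖∑ j ∈ Finset.range k, a (N + j) * g (N + j) ω‖ₑ ≤ ENNReal.ofReal (1 / ((m : ℝ) + 1))} ≤
          4 * ENNReal.ofReal (Real.exp (-((s : ℝ) + 1) ^ 2 / 2)) := by
      intro s
      have hlim : Tendsto (fun N => ENNReal.ofReal (2 * ((s : ℝ) + 1)) *
          l2Norm fun n => a (N + n)) atTop (𝓝 0) := by
        simpa using ENNReal.Tendsto.const_mul (tendsto_l2Norm_shift ha)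
          (Or.inr (ENNReal.ofReal_ne_top (r := 2 * ((s : ℝ) + 1))))
      obtain ⟨N, hN⟩ := (hlim.eventually (gt_mem_nhds hε)).exists
      refine (measure_mono ?_).trans (measure_exists_lt_enorm_sum_le (hg.shift N)
        (fun n => a (N + n)) (s := (s : ℝ) + 1) (by positivity))
      intro ω hω
      simp only [Set.mem_ofPred_eq, not_exists, not_forall, not_le] at hω ⊢
      obtain ⟨k, hk⟩ := hω N
      exact ⟨k, hN.trans hk⟩
    have hlim : Tendsto (fun s : ℕ => 4 * ENNReal.ofReal (Real.exp (-((s : ℝ) + 1) ^ 2 / 2)))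
        atTop (𝓝 0) := by
      have h0 : Tendsto (fun s : ℕ => Real.exp (-((s : ℝ) + 1) ^ 2 / 2)) atTop (𝓝 0) := by
        refine Real.tendsto_exp_atBot.comp ?_
        refine tendsto_atBot_mono (f := fun s : ℕ => -((s : ℝ) / 2)) (fun s => ?_) ?_
        · nlinarith [Nat.cast_nonneg (α := ℝ) s]
        · exact tendsto_neg_atTop_atBot.comp
            (tendsto_natCast_atTop_atTop.atTop_div_const (by norm_num))
      have h1 := ENNReal.tendsto_ofReal h0
      rw [ENNReal.ofReal_zero] at h1
      simpa using ENNReal.Tendsto.const_mul h1 (Or.inr (by norm_num : (4 : ℝ≥0∞) ≠ ∞))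
    exact le_antisymm (ge_of_tendsto' hlim hbound) zero_le
  filter_upwards [ae_all_iff.mpr key] with ω hω
  refine cauchySeq_tendsto_of_complete (Metric.cauchySeq_iff'.mpr fun ε hε => ?_)
  obtain ⟨m, hm⟩ := exists_nat_one_div_lt hε
  obtain ⟨N, hN⟩ := hω m
  refine ⟨N, fun n hn => ?_⟩
  obtain ⟨k, rfl⟩ := Nat.exists_eq_add_of_le hn
  rw [dist_eq_norm, Finset.sum_range_add, add_sub_cancel_left]
  refine lt_of_le_of_lt ?_ hm
  have := hN k
  rwa [← ofReal_norm, ENNReal.ofReal_le_ofReal_iff (by positivity)] at this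

end UniformBounds

/-! ### Conditioning on the random coefficients -/

section Transfer

variable {Ω : Type*} [MeasurableSpace Ω] {P : Measure Ω} [IsProbabilityMeasure P]

/-- Independence makes the joint law a product, so Fubini allows `Y` to be frozen while only `X` is
random. -/
lemma ae_mem_of_indepFun {E F : Type*} [MeasurableSpace E] [MeasurableSpace F] {X : Ω → E}
    {Y : Ω → F} (hX : Measurable X) (hY : Measurable Y) (hind : IndepFun Y X P) {s : Set (F × E)}
    (hs : MeasurableSet s) (H : ∀ᵐ ω' ∂P, ∀ᵐ ω ∂P, (Y ω', X ω) ∈ s) :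
    ∀ᵐ ω ∂P, (Y ω, X ω) ∈ s := by
  have := Measure.isProbabilityMeasure_map (μ := P) hX.aemeasurable
  have := Measure.isProbabilityMeasure_map (μ := P) hY.aemeasurable
  have hlaw := (indepFun_iff_map_prod_eq_prod_map_map hY.aemeasurable hX.aemeasurable).mp hind
  have hprod : ∀ᵐ z ∂(P.map Y).prod (P.map X), z ∈ s := by
    rw [Measure.ae_prod_mem_iff_ae_ae_mem hs, ae_map_iff hY.aemeasurable]
    · filter_upwards [H] with ω' h
      rw [ae_map_iff hX.aemeasurable]
      · exact h
      · exact measurable_prodMk_left hs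
    · have := measurable_measure_prodMk_left (ν := P.map X) hs.compl
      exact this (measurableSet_singleton 0)
  rw [← hlaw] at hprod
  exact (ae_map_iff (hY.prodMk hX).aemeasurable hs).mp hprod

variable {d : ℕ} {lo hi : Fin d → ℝ} {W : ℕ → Ω → box lo hi → ℂ} {g : ℕ → Ω → ℂ}

omit [IsProbabilityMeasure P] in
lemma IsCondSubGaussianSeries.isSymmSubGaussianSeq (h : IsCondSubGaussianSeries P W g) :
    IsSymmSubGaussianSeq P g :=
  ⟨h.measurable_g, h.indep_g, h.symmetric_g, h.subGaussian_g⟩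

lemma IsCondSubGaussianSeries.ae_mem (h : IsCondSubGaussianSeries P W g)
    {s : Set ((ℕ → box lo hi → ℂ) × (ℕ → ℂ))} (hs : MeasurableSet s)
    (H : ∀ᵐ ω' ∂P, ∀ᵐ ω ∂P, ((fun n x => W n ω' x), (fun n => g n ω)) ∈ s) :
    ∀ᵐ ω ∂P, ((fun n x => W n ω x), (fun n => g n ω)) ∈ s :=
  ae_mem_of_indepFun (X := fun ω n => g n ω) (Y := fun ω n x => W n ω x)
    (measurable_pi_iff.mpr h.measurable_g)
    (measurable_pi_iff.mpr fun n => measurable_pi_iff.mpr fun x => h.measurable_W n x)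
    h.indep_sequences.symm hs H

lemma IsCondSubGaussianSeries.ae_converges (h : IsCondSubGaussianSeries P W g) (x : box lo hi) :
    ∀ᵐ ω ∂P, Converges W g ω x := by
  refine h.ae_mem (s := {z | ∃ l, Tendsto (fun N => ∑ n ∈ Finset.range N, z.1 n x * z.2 n)
    atTop (𝓝 l)}) (measurableSet_exists_tendsto fun N => ?_) ?_
  · fun_prop
  · filter_upwards [h.summable_W x] with ω' hω'
    refine ae_exists_tendsto_sum h.isSymmSubGaussianSeq (a := fun n => W n ω' x) ?_
    have h2 : ∑' n, ‖W n ω' x‖ₑ ^ 2 ≠ ∞ := by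
      have := hω'.tsum_ofReal_ne_top
      simpa only [ENNReal.ofReal_pow (norm_nonneg _), ofReal_norm] using this
    exact ENNReal.rpow_ne_top_of_nonneg (by norm_num) h2

/-- Pairs get the weight `c p + c q`, whose negative exponential factors and hence is summable.
Countability of `ι` also makes the event measurable, as the transfer requires. -/
lemma IsCondSubGaussianSeries.ae_exists_forall_increment_le (h : IsCondSubGaussianSeries P W g)
    {ι : Type*} [Countable ι] (pt : ι → box lo hi) {c : ι → ℝ} (hc0 : ∀ i, 0 ≤ c i)
    (hc : Summable fun i => Real.exp (-c i)) :
    ∀ᵐ ω ∂P, ∃ A : ℕ, ∀ p q N k,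
      ‖(partialSum W g (N + k) ω (pt p) - partialSum W g N ω (pt p)) -
        (partialSum W g (N + k) ω (pt q) - partialSum W g N ω (pt q))‖ₑ ≤
        ENNReal.ofReal (A * √(c p + c q + Real.log ((N : ℝ) + 2))) *
          tailParam W N ω (pt p) (pt q) := by
  have hmeas : MeasurableSet {z : (ℕ → box lo hi → ℂ) × (ℕ → ℂ) | ∃ A : ℕ, ∀ (p : ι × ι) (N k : ℕ),
      ‖∑ j ∈ Finset.range k, (z.1 (N + j) (pt p.1) - z.1 (N + j) (pt p.2)) * z.2 (N + j)‖ₑ ≤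
        ENNReal.ofReal (A * √(c p.1 + c p.2 + Real.log ((N : ℝ) + 2))) *
          l2Norm fun n => z.1 (N + n) (pt p.1) - z.1 (N + n) (pt p.2)} := by
    refine measurableSet_setOfPred.mpr (Measurable.exists fun A => Measurable.forall fun p =>
      Measurable.forall fun N => Measurable.forall fun k => measurableSet_setOfPred.mp ?_)
    refine measurableSet_le (by fun_prop) ?_
    unfold l2Norm
    refine Measurable.const_mul (Measurable.pow_const (Measurable.tsum fun n => ?_) _) _
    fun_prop
  have key := h.ae_mem hmeas (ae_of_all _ fun ω' => ?_)
  · filter_upwards [key] with ω hω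
    obtain ⟨A, hA⟩ := hω
    refine ⟨A, fun p q N k => ?_⟩
    have e : (partialSum W g (N + k) ω (pt p) - partialSum W g N ω (pt p)) -
        (partialSum W g (N + k) ω (pt q) - partialSum W g N ω (pt q)) =
        ∑ j ∈ Finset.range k, (W (N + j) ω (pt p) - W (N + j) ω (pt q)) * g (N + j) ω := by
      simp only [partialSum, Finset.sum_range_add, add_sub_cancel_left, sub_mul,
        Finset.sum_sub_distrib]
    rw [e]
    exact hA (p, q) N k
  · refine ae_exists_forall_enorm_sum_le h.isSymmSubGaussianSeq
      (fun (p : ι × ι) n => W n ω' (pt p.1) - W n ω' (pt p.2)) (c := fun p => c p.1 + c p.2)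
      (fun p => add_nonneg (hc0 _) (hc0 _)) ?_
    simpa only [neg_add, Real.exp_add] using hc.mul_of_nonneg hc (fun i => (Real.exp_pos _).le)
      (fun i => (Real.exp_pos _).le)

end Transfer

/-! ### Nets of the box with exponential cardinality -/

section Nets

variable {d : ℕ} {lo hi : Fin d → ℝ}

/-- Finite nets of the box at all scales `exp (-k)`, for the Euclidean norm and for `ρ`, together
with weights that grow at most linearly in `k` and have summable negative exponentials. -/
structure ScaleNet (lo hi : Fin d → ℝ) (ρ : Space d → Space d → ℝ) where
  ι : Type
  countable : Countable ι
  pt : ι → box lo hi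
  weight : ι → ℝ
  weight_nonneg : ∀ i, 0 ≤ weight i
  summable_weight : Summable fun i => Real.exp (-weight i)
  proj : ℕ → box lo hi → ι
  rate : ℝ
  rate_nonneg : 0 ≤ rate
  weight_proj_le : ∀ k x, weight (proj k x) ≤ rate * (k + 1)
  norm_proj_sub_le : ∀ k x, ‖(pt (proj k x) : Space d) - x‖ ≤ Real.exp (-k)
  rho_proj_le : ∀ k x, ρ (pt (proj k x)) x ≤ Real.exp (-k)

lemma norm_le_of_forall_abs_le (x : Space d) {ε : ℝ} (h : ∀ j, |x j| ≤ ε / (d + 1))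
    (hε : 0 ≤ ε) : ‖x‖ ≤ ε := by
  rw [EuclideanSpace.norm_eq]
  refine Real.sqrt_le_iff.mpr ⟨hε, ?_⟩
  have hd : (0 : ℝ) ≤ d := Nat.cast_nonneg d
  calc ∑ j, ‖x j‖ ^ 2 ≤ ∑ _j : Fin d, (ε / (d + 1)) ^ 2 :=
        Finset.sum_le_sum fun j _ => pow_le_pow_left₀ (norm_nonneg _) (h j) 2
    _ = ε ^ 2 * (d / (d + 1) ^ 2) := by
        rw [Finset.sum_const, Finset.card_univ, Fintype.card_fin, nsmul_eq_mul]
        field_simp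
    _ ≤ ε ^ 2 * 1 := by
        refine mul_le_mul_of_nonneg_left ?_ (sq_nonneg _)
        rw [div_le_one (by positivity)]
        nlinarith
    _ = ε ^ 2 := mul_one _

lemma exists_finite_net (x₀ : box lo hi) : ∃ (Q : ℕ → ℕ) (pt : ∀ k, Fin (Q k) → box lo hi) (C : ℝ),
    0 ≤ C ∧ (∀ k, (Q k : ℝ) ≤ Real.exp (C * (k + 1))) ∧
      ∀ k (x : box lo hi), ∃ u, ‖(pt k u : Space d) - x‖ ≤ Real.exp (-k) := by
  have hlohi : ∀ j, lo j ≤ hi j := fun j => (x₀.2 j).1.trans (x₀.2 j).2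
  obtain ⟨L, hL⟩ : ∃ L : ℕ, ∀ j, hi j - lo j < L := by
    obtain ⟨L, hL⟩ := exists_nat_gt (∑ j, (hi j - lo j))
    exact ⟨L, fun j => lt_of_le_of_lt (Finset.single_le_sum (f := fun j => hi j - lo j)
      (fun i _ => sub_nonneg.mpr (hlohi i)) (Finset.mem_univ j)) hL⟩
  -- Since `3 > e`, the mesh `1 / q k` is fine enough; the factor `d + 1` pays for passing from
  -- coordinates to the Euclidean norm. Truncation at `hi` keeps every grid point in the box.
  set q : ℕ → ℕ := fun k => (d + 1) * 3 ^ k with hq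
  have hqpos : ∀ k, (0 : ℝ) < q k := fun k => by
    simp only [hq]
    positivity
  let code : ℕ → Type := fun k => Fin d → Fin (L * q k)
  let e : ∀ k, code k ≃ Fin (Fintype.card (code k)) := fun k => Fintype.equivFin _
  let pt' : ∀ k, code k → box lo hi := fun k u =>
    ⟨WithLp.toLp 2 fun j => min (lo j + ((u j : ℕ) : ℝ) / q k) (hi j), fun j =>
      ⟨le_min (le_add_of_nonneg_right (by positivity)) (hlohi j), min_le_right _ _⟩⟩
  refine ⟨fun k => Fintype.card (code k), fun k u => pt' k ((e k).symm u),
    Real.log (((3 * (L + 1) * (d + 1) : ℕ) : ℝ) ^ d), ?_, ?_, ?_⟩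
  · refine Real.log_nonneg (one_le_pow₀ ?_)
    have : 1 ≤ 3 * (L + 1) * (d + 1) := Nat.one_le_iff_ne_zero.mpr (by positivity)
    exact_mod_cast this
  · intro k
    have hexp : Real.exp (Real.log (((3 * (L + 1) * (d + 1) : ℕ) : ℝ) ^ d) * ((k : ℝ) + 1)) =
        ((((3 * (L + 1) * (d + 1)) ^ d) ^ (k + 1) : ℕ) : ℝ) := by
      have : (((3 * (L + 1) * (d + 1) : ℕ) : ℝ) ^ d) > 0 := by positivity
      rw [mul_comm, show ((k : ℝ) + 1) = ((k + 1 : ℕ) : ℝ) by push_cast; ring, Real.exp_nat_mul,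
        Real.exp_log this]
      push_cast
      ring
    rw [hexp, Nat.cast_le]
    simp only [code, Fintype.card_pi, Fintype.card_fin, Finset.prod_const, Finset.card_univ]
    rw [← pow_mul, mul_comm d, pow_mul]
    refine Nat.pow_le_pow_left ?_ d
    calc L * q k ≤ ((L + 1) * (d + 1)) * 3 ^ (k + 1) := by
          simp only [hq]
          rw [← mul_assoc]
          exact Nat.mul_le_mul (Nat.mul_le_mul (Nat.le_succ L) le_rfl)
            (Nat.pow_le_pow_right (by norm_num) (Nat.le_succ k))
      _ ≤ ((L + 1) * (d + 1)) ^ (k + 1) * 3 ^ (k + 1) :=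
          Nat.mul_le_mul_right _ (Nat.le_self_pow (Nat.succ_ne_zero k) _)
      _ = (3 * (L + 1) * (d + 1)) ^ (k + 1) := by
          rw [← mul_pow]
          ring_nf
  · intro k x
    have hx0 : ∀ j, 0 ≤ ((x : Space d) j - lo j) * q k := fun j =>
      mul_nonneg (sub_nonneg.mpr (x.2 j).1) (hqpos k).le
    have hlt : ∀ j, ⌊((x : Space d) j - lo j) * q k⌋₊ < L * q k := by
      intro j
      rw [Nat.floor_lt (hx0 j)]
      push_cast
      refine mul_lt_mul_of_pos_right ?_ (hqpos k)
      linarith [hL j, (x.2 j).2]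
    let u : code k := fun j => ⟨⌊((x : Space d) j - lo j) * q k⌋₊, hlt j⟩
    refine ⟨e k u, ?_⟩
    simp only [Equiv.symm_apply_apply]
    refine (norm_le_of_forall_abs_le (ε := 1 / 3 ^ k) _ (fun j => ?_) (by positivity)).trans ?_
    · have hval : (pt' k u : Space d) j =
          lo j + (⌊((x : Space d) j - lo j) * q k⌋₊ : ℝ) / q k := by
        refine min_eq_left ?_
        have := Nat.floor_le (hx0 j)
        have h2 : (⌊((x : Space d) j - lo j) * q k⌋₊ : ℝ) / q k ≤ (x : Space d) j - lo j := by
          rwa [div_le_iff₀ (hqpos k)]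
        have := (x.2 j).2
        linarith
      have hmesh : (1 : ℝ) / 3 ^ k / (d + 1) = 1 / q k := by
        simp only [hq]
        push_cast
        field_simp
      rw [PiLp.sub_apply, hval, hmesh]
      have h1 := Nat.floor_le (hx0 j)
      have h2 := (Nat.lt_floor_add_one (((x : Space d) j - lo j) * q k)).le
      have h1' : (⌊((x : Space d) j - lo j) * q k⌋₊ : ℝ) / q k ≤ (x : Space d) j - lo j := by
        rwa [div_le_iff₀ (hqpos k)]
      have h2' : (x : Space d) j - lo j ≤
          (⌊((x : Space d) j - lo j) * q k⌋₊ : ℝ) / q k + 1 / q k := by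
        rwa [← add_div, le_div_iff₀ (hqpos k)]
      rw [abs_le]
      constructor
      · linarith
      · have : 0 < 1 / (q k : ℝ) := one_div_pos.mpr (hqpos k)
        linarith
    · rw [Real.exp_neg, one_div, ← Real.exp_one_pow]
      refine inv_anti₀ (by positivity) (pow_le_pow_left₀ (Real.exp_pos _).le ?_ k)
      linarith [Real.exp_one_lt_d9]

lemma nonempty_scaleNet (x₀ : box lo hi) {ρ : Space d → Space d → ℝ}
    (hρ : LocallyHolderComparable ρ) : Nonempty (ScaleNet lo hi ρ) := by
  obtain ⟨Q, pt, C, hC, hQ, hpt⟩ := exists_finite_net x₀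
  obtain ⟨H, _, _, c, hH, _, _, _, hc, hcomp⟩ := hρ
  obtain ⟨m, hm⟩ := exists_nat_ge (1 / H)
  obtain ⟨p, hp⟩ := exists_nat_ge c
  have hmH : 1 ≤ m * H := by rwa [div_le_iff₀ hH] at hm
  have hm1 : 1 ≤ m := by
    rcases Nat.eq_zero_or_pos m with h | h
    · simp [h] at hmH
      linarith
    · exact h
  choose u hu using hpt
  -- Scale `k` uses the Euclidean net of level `m * (k + p)`: since `m * H ≥ 1` and `exp p ≥ c`, its
  -- `ρ`-error is at most `exp (-k)`. The product in `D` offsets the cardinality of that net; the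
  -- final `+ 1` leaves `exp (-k)` to be summed.
  set D := C * (m * (p + 1) + 1) + 1 with hD
  have hD0 : 0 ≤ D := by positivity
  have hlevel : ∀ k : ℕ, (k : ℝ) ≤ ((m * (k + p) : ℕ) : ℝ) := fun k => by
    have : k ≤ m * (k + p) := by nlinarith
    exact_mod_cast this
  refine ⟨⟨Σ k, Fin (Q (m * (k + p))), inferInstance, fun i => pt _ i.2,
    fun i => D * (i.1 + 1), fun i => by positivity, ?_, fun k x => ⟨k, u _ x⟩, D, hD0,
    fun k x => le_rfl, fun k x => ?_, fun k x => ?_⟩⟩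
  · rw [summable_sigma_of_nonneg fun i => (Real.exp_pos _).le]
    refine ⟨fun k => (hasSum_fintype _).summable, ?_⟩
    simp only [tsum_fintype, Finset.sum_const, Finset.card_univ, Fintype.card_fin, nsmul_eq_mul]
    refine Summable.of_nonneg_of_le (fun k => by positivity) (fun k => ?_) Real.summable_exp_neg_nat
    calc (Q (m * (k + p)) : ℝ) * Real.exp (-(D * (k + 1)))
        ≤ Real.exp (C * (((m * (k + p) : ℕ) : ℝ) + 1)) * Real.exp (-(D * (k + 1))) :=
          mul_le_mul_of_nonneg_right (hQ _) (Real.exp_pos _).le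
      _ ≤ Real.exp (-k) := by
          rw [← Real.exp_add, Real.exp_le_exp, hD]
          push_cast
          have h1 : (m : ℝ) * (k + p) + 1 ≤ (m * (p + 1) + 1) * (k + 1) := by
            have : 0 ≤ (m : ℝ) * (p * k) := by positivity
            have := Nat.cast_nonneg (α := ℝ) k
            nlinarith [Nat.cast_nonneg (α := ℝ) m]
          have h2 := mul_le_mul_of_nonneg_left h1 hC
          nlinarith
  · exact (hu _ x).trans (Real.exp_le_exp.mpr (neg_le_neg (hlevel k)))
  · have hn := hu (m * (k + p)) x
    refine (hcomp _ _ (hn.trans ?_)).2.trans ?_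
    · rw [Real.exp_le_one_iff, neg_nonpos]
      exact Nat.cast_nonneg _
    · calc c * ‖(pt (m * (k + p)) (u (m * (k + p)) x) : Space d) - x‖ ^ H
          ≤ Real.exp p * Real.exp (-((m * (k + p) : ℕ) : ℝ)) ^ H := by
            refine mul_le_mul ?_ (Real.rpow_le_rpow (norm_nonneg _) hn hH.le) (by positivity)
              (by positivity)
            linarith [Real.add_one_le_exp (p : ℝ)]
        _ ≤ Real.exp (-k) := by
            rw [← Real.exp_mul, ← Real.exp_add, Real.exp_le_exp]
            push_cast
            have : 0 ≤ (k : ℝ) + p := by positivity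
            nlinarith [mul_le_mul_of_nonneg_right hmH this]

end Nets

/-! ### Regularity of the modulus in the logarithmic scale -/

section Modulus

/-- The modulus `h ^ β * |log h| ^ α` in the logarithmic scale `h = exp (-s)`. -/
noncomputable def expModulus (β α s : ℝ) : ℝ := Real.exp (-β * s) * s ^ α

lemma expModulus_nonneg (β α : ℝ) {s : ℝ} (hs : 0 ≤ s) : 0 ≤ expModulus β α s :=
  mul_nonneg (Real.exp_pos _).le (Real.rpow_nonneg hs _)

lemma logModulus_eq_ofReal_expModulus (β α : ℝ) {h : ℝ} (h0 : 0 < h) (h1 : h < 1) :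
    logModulus β α h = ENNReal.ofReal (expModulus β α (-Real.log h)) := by
  have hlog : 0 < -Real.log h := neg_pos.mpr (Real.log_neg h0 h1)
  rw [logModulus, expModulus, abs_of_neg (Real.log_neg h0 h1), ENNReal.ofReal_rpow_of_pos h0,
    ENNReal.ofReal_rpow_of_pos hlog, ← ENNReal.ofReal_mul (by positivity), Real.rpow_def_of_pos h0]
  congr 3
  ring

/-- All follows from `s ≤ s + t ≤ (1 + t) * s`; the absolute value of `α` treats both monotonicities
of the power together. -/
lemma rpow_add_le {s t : ℝ} (hs : 1 ≤ s) (ht : 0 ≤ t) (α : ℝ) :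
    (s + t) ^ α ≤ (1 + t) ^ |α| * s ^ α ∧ s ^ α ≤ (1 + t) ^ |α| * (s + t) ^ α := by
  have hs0 : 0 < s := by linarith
  have h1 : 1 ≤ (1 + t) ^ |α| := Real.one_le_rpow (by linarith) (abs_nonneg _)
  have hst : s + t ≤ (1 + t) * s := by nlinarith
  rcases le_total 0 α with hα | hα
  · rw [abs_of_nonneg hα] at *
    constructor
    · rw [← Real.mul_rpow (by linarith) hs0.le]
      exact Real.rpow_le_rpow (by linarith) hst hα
    · calc s ^ α ≤ (s + t) ^ α := Real.rpow_le_rpow hs0.le (by linarith) hα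
        _ ≤ _ := le_mul_of_one_le_left (by positivity) h1
  · rw [abs_of_nonpos hα] at *
    constructor
    · calc (s + t) ^ α ≤ s ^ α := Real.rpow_le_rpow_of_nonpos hs0 (by linarith) hα
        _ ≤ _ := le_mul_of_one_le_left (by positivity) h1
    · have := Real.rpow_le_rpow_of_nonpos (by linarith : 0 < s + t) hst hα
      rw [Real.mul_rpow (by linarith) hs0.le] at this
      rw [Real.rpow_neg (by linarith), ← div_eq_inv_mul, le_div_iff₀ (by positivity), mul_comm]
      exact this

/-- Half of the exponential decay absorbs the factor `(1 + t) ^ |α|`. The remaining half makes the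
chaining sums geometric. -/
lemma exists_expModulus_add_le {β : ℝ} (hβ : 0 < β) (α : ℝ) : ∃ C : ℝ, 0 < C ∧ ∀ s t : ℝ,
    1 ≤ s → 0 ≤ t → expModulus β α (s + t) ≤ C * Real.exp (-(β / 2) * t) * expModulus β α s := by
  set θ := β / (2 * (|α| + 1)) with hθ
  have hα := abs_nonneg α
  have hθ0 : 0 < θ := by positivity
  refine ⟨(1 + 1 / θ) ^ |α|, by positivity, fun s t hs ht => ?_⟩
  have hs0 : 0 < s := by linarith
  have h1 : 1 + t ≤ (1 + 1 / θ) * Real.exp (θ * t) := by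
    have h2 := Real.add_one_le_exp (θ * t)
    have h3 : 1 / θ * (θ * t) = t := by field_simp
    have h4 : 0 < 1 / θ := by positivity
    nlinarith [mul_le_mul_of_nonneg_left h2 (by positivity : 0 ≤ 1 + 1 / θ), mul_nonneg hθ0.le ht]
  have h5 : (1 + t) ^ |α| ≤ (1 + 1 / θ) ^ |α| * Real.exp (β / 2 * t) := by
    refine (Real.rpow_le_rpow (by linarith) h1 hα).trans ?_
    rw [Real.mul_rpow (by positivity) (by positivity), ← Real.exp_mul]
    refine mul_le_mul_of_nonneg_left (Real.exp_le_exp.mpr ?_) (by positivity)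
    have h6 : θ * |α| ≤ β / 2 := by
      rw [hθ, div_mul_eq_mul_div, div_le_div_iff₀ (by positivity) (by norm_num)]
      nlinarith
    nlinarith [mul_le_mul_of_nonneg_right h6 ht]
  have h7 : Real.exp (-β * (s + t)) * Real.exp (β / 2 * t) =
      Real.exp (-(β / 2) * t) * Real.exp (-β * s) := by
    rw [← Real.exp_add, ← Real.exp_add]
    ring_nf
  calc expModulus β α (s + t)
      ≤ Real.exp (-β * (s + t)) * (((1 + 1 / θ) ^ |α| * Real.exp (β / 2 * t)) * s ^ α) := by
        refine mul_le_mul_of_nonneg_left ((rpow_add_le hs ht α).1.trans ?_) (by positivity)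
        exact mul_le_mul_of_nonneg_right h5 (by positivity)
    _ = (1 + 1 / θ) ^ |α| * (Real.exp (-β * (s + t)) * Real.exp (β / 2 * t)) * s ^ α := by ring
    _ = _ := by
        rw [h7, expModulus]
        ring

lemma exists_expModulus_le_add {β : ℝ} (hβ : 0 < β) (α : ℝ) {q : ℝ} (hq : 0 ≤ q) :
    ∃ C : ℝ, 0 < C ∧ ∀ s t : ℝ, 1 ≤ s → 0 ≤ t → t ≤ q →
      expModulus β α s ≤ C * expModulus β α (s + t) := by
  refine ⟨Real.exp (β * q) * (1 + q) ^ |α|, by positivity, fun s t hs ht htq => ?_⟩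
  have hs0 : 0 < s := by linarith
  have h1 : Real.exp (-β * s) ≤ Real.exp (β * q) * Real.exp (-β * (s + t)) := by
    rw [← Real.exp_add, Real.exp_le_exp]
    nlinarith
  have h2 : s ^ α ≤ (1 + q) ^ |α| * (s + t) ^ α :=
    (rpow_add_le hs ht α).2.trans (mul_le_mul_of_nonneg_right
      (Real.rpow_le_rpow (by linarith) (by linarith) (abs_nonneg α)) (by positivity))
  calc expModulus β α s
      ≤ (Real.exp (β * q) * Real.exp (-β * (s + t))) * ((1 + q) ^ |α| * (s + t) ^ α) :=
        mul_le_mul h1 h2 (by positivity) (by positivity)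
    _ = _ := by
        rw [expModulus]
        ring

/-- A substitute for monotonicity, which can fail when `α > 0`. -/
lemma exists_logModulus_le {β : ℝ} (hβ : 0 < β) (α : ℝ) : ∃ C : ℝ, 0 < C ∧ ∀ s h : ℝ, 1 ≤ s →
    0 ≤ h → h ≤ Real.exp (-s) → logModulus β α h ≤ ENNReal.ofReal (C * expModulus β α s) := by
  obtain ⟨C, hC, H⟩ := exists_expModulus_add_le hβ α
  refine ⟨C, hC, fun s h hs h0 hh => ?_⟩
  rcases h0.eq_or_lt with rfl | h0
  · simp [logModulus, ENNReal.zero_rpow_of_pos hβ]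
  have h1 : h < 1 := hh.trans_lt (by rw [Real.exp_lt_one_iff]; linarith)
  rw [logModulus_eq_ofReal_expModulus β α h0 h1]
  refine ENNReal.ofReal_le_ofReal ?_
  have hlog : s ≤ -Real.log h := by
    have := Real.log_le_log h0 hh
    rw [Real.log_exp] at this
    linarith
  have := H s (-Real.log h - s) hs (by linarith)
  rw [add_sub_cancel] at this
  refine this.trans (mul_le_mul_of_nonneg_right ?_ (expModulus_nonneg _ _ (by linarith)))
  refine mul_le_of_le_one_right hC.le ?_
  rw [Real.exp_le_one_iff]
  nlinarith

lemma exists_le_logModulus {β : ℝ} (hβ : 0 < β) (α : ℝ) : ∃ C : ℝ, 0 < C ∧ ∀ n h : ℝ, 1 ≤ n →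
    h ≤ Real.exp (-n) → Real.exp (-(n + 1)) ≤ h →
      ENNReal.ofReal (expModulus β α n) ≤ ENNReal.ofReal C * logModulus β α h := by
  obtain ⟨C, hC, H⟩ := exists_expModulus_le_add hβ α zero_le_one
  refine ⟨C, hC, fun n h hn hh hh' => ?_⟩
  have h0 : 0 < h := (Real.exp_pos _).trans_le hh'
  have h1 : h < 1 := hh.trans_lt (by rw [Real.exp_lt_one_iff]; linarith)
  have hl : n ≤ -Real.log h := by
    have := Real.log_le_log h0 hh
    rw [Real.log_exp] at this
    linarith
  have hu : -Real.log h ≤ n + 1 := by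
    have := Real.log_le_log (Real.exp_pos _) hh'
    rw [Real.log_exp] at this
    linarith
  rw [logModulus_eq_ofReal_expModulus β α h0 h1, ← ENNReal.ofReal_mul hC.le]
  refine ENNReal.ofReal_le_ofReal ?_
  have := H n (-Real.log h - n) hn (by linarith) (by linarith)
  rwa [add_sub_cancel] at this

/-- This is where the exponent of the logarithm gains `1 / 2`: the `√s` comes from the weights at
scale `s`. -/
lemma expModulus_mul_sqrt (β α : ℝ) {s : ℝ} (hs : 0 < s) :
    expModulus β α s * √s = expModulus β (α + 1 / 2) s := by
  rw [expModulus, expModulus, mul_assoc, Real.sqrt_eq_rpow, ← Real.rpow_add hs]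

lemma tendsto_expModulus {β : ℝ} (hβ : 0 < β) (α : ℝ) :
    Tendsto (fun n : ℕ => expModulus β α n) atTop (𝓝 0) := by
  obtain ⟨C, hC, H⟩ := exists_expModulus_add_le hβ α
  rw [← tendsto_add_atTop_iff_nat 1]
  have hlim : Tendsto (fun n : ℕ => C * Real.exp (-(β / 2) * n) * expModulus β α 1) atTop
      (𝓝 (C * 0 * expModulus β α 1)) := by
    refine ((Real.tendsto_exp_atBot.comp ?_).const_mul C).mul_const _
    exact tendsto_natCast_atTop_atTop.const_mul_atTop_of_neg (by linarith)
  rw [mul_zero, zero_mul] at hlim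
  refine squeeze_zero (fun n => expModulus_nonneg _ _ (Nat.cast_nonneg _)) (fun n => ?_) hlim
  have := H 1 n le_rfl (Nat.cast_nonneg n)
  rw [add_comm] at this
  exact_mod_cast this

end Modulus

/-! ### From net points to all points -/

section Chaining

variable {d : ℕ} {lo hi : Fin d → ℝ} {ρ : Space d → Space d → ℝ}

lemma ScaleNet.tendsto_pt_proj (S : ScaleNet lo hi ρ) (x : box lo hi) :
    Tendsto (fun k => S.pt (S.proj k x)) atTop (𝓝 x) := by
  rw [tendsto_subtype_rng, tendsto_iff_norm_sub_tendsto_zero]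
  refine squeeze_zero (fun k => norm_nonneg _) (fun k => S.norm_proj_sub_le k x) ?_
  exact Real.tendsto_exp_atBot.comp (tendsto_neg_atTop_atBot.comp tendsto_natCast_atTop_atTop)

/-- The increments of `D` between the net points in the ball `B(x₀, γ)` are at most
`B * ρ ^ β * |log ρ| ^ η`, up to the logarithmic factor given by the weights and by `L`. -/
def NetIncrementBound (S : ScaleNet lo hi ρ) (x₀ : box lo hi) (γ β η B L : ℝ)
    (D : box lo hi → ℂ) : Prop :=
  ∀ p q, ‖(S.pt p : Space d) - x₀‖ ≤ γ → ‖(S.pt q : Space d) - x₀‖ ≤ γ →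
    ‖D (S.pt p) - D (S.pt q)‖ₑ ≤ ENNReal.ofReal (√(S.weight p + S.weight q + L)) *
      (ENNReal.ofReal B * logModulus β η (ρ (S.pt p) (S.pt q)))

/-- One link of the chain at scale `k`. The shift `q` leaves room for the constant lost in the
quasi-triangle inequality; it costs only a constant factor in the modulus. -/
lemma exists_norm_sub_le_of_rho_le (S : ScaleNet lo hi ρ) {β : ℝ} (hβ : 0 < β) (η : ℝ) (q : ℕ) :
    ∃ C : ℝ, 0 < C ∧ ∀ (x₀ : box lo hi) (γ B L : ℝ) (D : box lo hi → ℂ), 0 ≤ B → 1 / 2 ≤ L →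
      NetIncrementBound S x₀ γ β η B L D → ∀ (k : ℕ) (i j : S.ι), q + 1 ≤ k →
        ‖(S.pt i : Space d) - x₀‖ ≤ γ → ‖(S.pt j : Space d) - x₀‖ ≤ γ →
        0 ≤ ρ (S.pt i) (S.pt j) → ρ (S.pt i) (S.pt j) ≤ Real.exp (-((k : ℝ) - q)) →
        S.weight i ≤ S.rate * (k + 2) → S.weight j ≤ S.rate * (k + 2) →
          ‖D (S.pt i) - D (S.pt j)‖ ≤ C * (B * √L) * expModulus β (η + 1 / 2) k := by
  obtain ⟨C₁, hC₁, H₁⟩ := exists_logModulus_le hβ η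
  obtain ⟨C₂, hC₂, H₂⟩ := exists_expModulus_le_add hβ η (Nat.cast_nonneg (α := ℝ) q)
  have hr := S.rate_nonneg
  refine ⟨√(12 * S.rate + 1) * (C₁ * C₂), by positivity, ?_⟩
  intro x₀ γ B L D hB hL hD k i j hk hi hj hρ0 hρ hwi hwj
  have hkq : (q : ℝ) + 1 ≤ k := by exact_mod_cast hk
  have hq0 : (0 : ℝ) ≤ q := Nat.cast_nonneg q
  have hk0 : (0 : ℝ) < k := by linarith
  have hmod : logModulus β η (ρ (S.pt i) (S.pt j)) ≤
      ENNReal.ofReal (C₁ * (C₂ * expModulus β η k)) := by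
    refine (H₁ (k - q) _ (by linarith) hρ0 hρ).trans (ENNReal.ofReal_le_ofReal ?_)
    refine mul_le_mul_of_nonneg_left ?_ hC₁.le
    have := H₂ (k - q) q (by linarith) hq0 le_rfl
    rwa [sub_add_cancel] at this
  -- As `k ≥ 1` and `L ≥ 1 / 2`, the two weights total at most `6 * rate * k ≤ 12 * rate * k * L`,
  -- and `L ≤ k * L`.
  have hsqrt : √(S.weight i + S.weight j + L) ≤ √(12 * S.rate + 1) * √L * √k := by
    rw [← Real.sqrt_mul (by positivity), ← Real.sqrt_mul (by positivity)]
    refine Real.sqrt_le_sqrt ?_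
    have h1 : S.rate * (k + 2) ≤ S.rate * (3 * k) := mul_le_mul_of_nonneg_left (by linarith) hr
    have h2 : S.rate * k * (1 / 2) ≤ S.rate * k * L :=
      mul_le_mul_of_nonneg_left hL (by positivity)
    nlinarith
  have hE : 0 ≤ expModulus β η k := expModulus_nonneg _ _ hk0.le
  have key := (hD i j hi hj).trans (mul_le_mul' (ENNReal.ofReal_le_ofReal hsqrt)
    (mul_le_mul' le_rfl hmod))
  rw [← ENNReal.ofReal_mul hB, ← ENNReal.ofReal_mul (by positivity), ← ofReal_norm,
    ENNReal.ofReal_le_ofReal_iff (by positivity)] at key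
  refine key.trans (le_of_eq ?_)
  rw [← expModulus_mul_sqrt β η hk0]
  ring

/-- Chaining along the net: a bound for the increments between net points gives a bound for all
increments in a smaller ball, with constants that do not depend on the function. -/
lemma exists_chaining (S : ScaleNet lo hi ρ) (hρ : IsQuasiMetric ρ) {γ β : ℝ} (hγ : 0 < γ)
    (hβ : 0 < β) (η : ℝ) :
    ∃ (m : ℕ) (C : ℝ), 1 ≤ m ∧ 0 < C ∧ ∀ (x₀ : box lo hi) (B L : ℝ) (D : box lo hi → ℂ),
      Continuous D → 0 ≤ B → 1 / 2 ≤ L → NetIncrementBound S x₀ γ β η B L D → ∀ n : ℕ, m ≤ n →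
        ∀ x : box lo hi, ‖(x : Space d) - x₀‖ ≤ γ / 2 →
          ‖D x - D (S.pt (S.proj n x))‖ ≤ C * (B * √L) * expModulus β (η + 1 / 2) n ∧
          ∀ y : box lo hi, ‖(y : Space d) - x₀‖ ≤ γ / 2 → ρ x y ≤ Real.exp (-n) →
            ‖D x - D y‖ ≤ C * (B * √L) * expModulus β (η + 1 / 2) n := by
  obtain ⟨κ, hκ, htri⟩ := hρ.quasi_triangle
  -- Two uses of the quasi-triangle inequality put the projections of two points at distance `exp
  -- (-n)` within `(κ + 2 * κ ^ 2) * exp (-n)`, hence within `exp (-(n - q))`.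
  obtain ⟨q, hq⟩ := exists_nat_ge (3 * κ ^ 2)
  have hκq : 3 * κ ^ 2 ≤ Real.exp q := by linarith [Real.add_one_le_exp (q : ℝ)]
  obtain ⟨C₁, hC₁, H₁⟩ := exists_norm_sub_le_of_rho_le S hβ η q
  obtain ⟨C₂, hC₂, H₂⟩ := exists_expModulus_add_le hβ (η + 1 / 2)
  obtain ⟨k₀, hk₀⟩ : ∃ k₀ : ℕ, Real.exp (-k₀) ≤ γ / 2 := by
    have hlim : Tendsto (fun k : ℕ => Real.exp (-(k : ℝ))) atTop (𝓝 0) :=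
      Real.tendsto_exp_atBot.comp (tendsto_neg_atTop_atBot.comp tendsto_natCast_atTop_atTop)
    exact (hlim.eventually (ge_mem_nhds (half_pos hγ))).exists
  set r := Real.exp (-(β / 2)) with hr
  have hr1 : r < 1 := by
    rw [hr, Real.exp_lt_one_iff]
    linarith
  set C := C₁ * C₂ / (1 - r) with hC
  have hC0 : 0 < C := div_pos (by positivity) (by linarith)
  -- From `k₀` on, projections of points of the half ball stay in the ball of radius `γ`. The
  -- constant counts two geometric chains, from `x` and from `y`, and one link between their net
  -- points.
  refine ⟨max (q + 1) k₀, 2 * C + C₁, (Nat.le_add_left 1 q).trans (le_max_left _ _),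
    by positivity, ?_⟩
  intro x₀ B L D hcont hB hL hD n hn
  have hball : ∀ k : ℕ, n ≤ k → ∀ x : box lo hi, ‖(x : Space d) - x₀‖ ≤ γ / 2 →
      ‖(S.pt (S.proj k x) : Space d) - x₀‖ ≤ γ := by
    intro k hk x hx
    have h1 : Real.exp (-k) ≤ Real.exp (-k₀) := by
      rw [Real.exp_le_exp, neg_le_neg_iff]
      exact_mod_cast ((le_max_right _ _).trans hn).trans hk
    have h2 := norm_sub_le_norm_sub_add_norm_sub (S.pt (S.proj k x) : Space d) x x₀
    linarith [S.norm_proj_sub_le k x]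
  have hqn : q + 1 ≤ n := (le_max_left _ _).trans hn
  have hscale : ∀ k : ℕ, 3 * κ ^ 2 * Real.exp (-k) ≤ Real.exp (-((k : ℝ) - q)) := by
    intro k
    rw [neg_sub, sub_eq_add_neg, Real.exp_add]
    exact mul_le_mul_of_nonneg_right hκq (Real.exp_pos _).le
  have hr0 := S.rate_nonneg
  have hW1 : ∀ k x, S.weight (S.proj k x) ≤ S.rate * (k + 2) := fun k x =>
    (S.weight_proj_le k x).trans (mul_le_mul_of_nonneg_left (by linarith) hr0)
  have hW2 : ∀ k x, S.weight (S.proj (k + 1) x) ≤ S.rate * (k + 2) := fun k x =>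
    (S.weight_proj_le (k + 1) x).trans (mul_le_mul_of_nonneg_left (by push_cast; linarith) hr0)
  have hn1 : (1 : ℝ) ≤ n := by exact_mod_cast (Nat.le_add_left 1 q).trans hqn
  have hF0 : 0 ≤ expModulus β (η + 1 / 2) n := expModulus_nonneg _ _ (by linarith)
  have hBL : 0 ≤ B * √L := by positivity
  have hproj : ∀ x : box lo hi, ‖(x : Space d) - x₀‖ ≤ γ / 2 →
      ‖D x - D (S.pt (S.proj n x))‖ ≤ C * (B * √L) * expModulus β (η + 1 / 2) n := by
    intro x hx
    have hstep : ∀ j : ℕ, dist (D (S.pt (S.proj (n + j) x))) (D (S.pt (S.proj (n + (j + 1)) x))) ≤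
        (C₁ * C₂ * (B * √L) * expModulus β (η + 1 / 2) n) * r ^ j := by
      intro j
      have hρj : ρ (S.pt (S.proj (n + j) x)) (S.pt (S.proj (n + (j + 1)) x)) ≤
          Real.exp (-(((n + j : ℕ) : ℝ) - q)) := by
        refine (htri _ x _).trans (le_trans ?_ (hscale (n + j)))
        have h1 := S.rho_proj_le (n + j) x
        have h2 := S.rho_proj_le (n + (j + 1)) x
        rw [hρ.symm] at h2
        have h3 : Real.exp (-((n + (j + 1) : ℕ) : ℝ)) ≤ Real.exp (-((n + j : ℕ) : ℝ)) := by
          rw [Real.exp_le_exp]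
          push_cast
          linarith
        have h4 : κ * (ρ (S.pt (S.proj (n + j) x)) x + ρ x (S.pt (S.proj (n + (j + 1)) x))) ≤
            κ * (2 * Real.exp (-((n + j : ℕ) : ℝ))) :=
          mul_le_mul_of_nonneg_left (by linarith) (by linarith)
        have h5 : 2 * κ ≤ 3 * κ ^ 2 := by nlinarith
        linarith [mul_le_mul_of_nonneg_right h5 (Real.exp_pos (-((n + j : ℕ) : ℝ))).le]
      have h := H₁ x₀ γ B L D hB hL hD (n + j) _ _ (by omega) (hball (n + j) (by omega) x hx)
        (hball (n + (j + 1)) (by omega) x hx) (hρ.nonneg _ _) hρj (hW1 _ x) (hW2 _ x)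
      have hF := H₂ n j hn1 (Nat.cast_nonneg j)
      rw [mul_comm (-(β / 2)), Real.exp_nat_mul, ← hr] at hF
      rw [dist_eq_norm]
      refine h.trans ?_
      push_cast
      refine (mul_le_mul_of_nonneg_left hF (by positivity)).trans (le_of_eq ?_)
      ring
    -- Continuity of `D` lets the telescoping sum reach `x` itself.
    have hlim : Tendsto (fun j => D (S.pt (S.proj (n + j) x))) atTop (𝓝 (D x)) := by
      have h1 := (hcont.tendsto x).comp (S.tendsto_pt_proj x)
      have h2 := h1.comp (tendsto_add_atTop_nat n)
      simpa only [Function.comp_def, add_comm] using h2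
    have := dist_le_of_le_geometric_of_tendsto₀ r _ hr1 hstep hlim
    rw [dist_comm, dist_eq_norm] at this
    refine this.trans (le_of_eq ?_)
    rw [hC]
    ring
  intro x hx
  have hnn : 0 ≤ C * (B * √L) * expModulus β (η + 1 / 2) n := by positivity
  have hnn₁ : 0 ≤ C₁ * (B * √L) * expModulus β (η + 1 / 2) n := by positivity
  refine ⟨(hproj x hx).trans (by linarith), fun y hy hxy => ?_⟩
  have hρn : ρ (S.pt (S.proj n x)) (S.pt (S.proj n y)) ≤ Real.exp (-((n : ℝ) - q)) := by
    refine (htri _ x _).trans (le_trans ?_ (hscale n))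
    have h1 := S.rho_proj_le n x
    have h2 := S.rho_proj_le n y
    rw [hρ.symm] at h2
    have h3 := htri x y (S.pt (S.proj n y))
    have h4 : κ * (ρ x y + ρ y (S.pt (S.proj n y))) ≤ κ * (2 * Real.exp (-n)) :=
      mul_le_mul_of_nonneg_left (by linarith) (by linarith)
    have h5 : κ * (ρ (S.pt (S.proj n x)) x + ρ x (S.pt (S.proj n y))) ≤
        κ * (Real.exp (-n) + κ * (2 * Real.exp (-n))) :=
      mul_le_mul_of_nonneg_left (by linarith) (by linarith)
    nlinarith [mul_nonneg (mul_nonneg (by linarith : (0 : ℝ) ≤ κ) (sub_nonneg.mpr hκ))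
      (Real.exp_pos (-(n : ℝ))).le]
  have hmid := H₁ x₀ γ B L D hB hL hD n _ _ hqn (hball n le_rfl x hx) (hball n le_rfl y hy)
    (hρ.nonneg _ _) hρn (hW1 n x) (hW1 n y)
  have h1 := norm_sub_le_norm_sub_add_norm_sub (D x) (D (S.pt (S.proj n x))) (D y)
  have h2 := norm_sub_le_norm_sub_add_norm_sub (D (S.pt (S.proj n x)))
    (D (S.pt (S.proj n y))) (D y)
  have h3 := hproj x hx
  have h4 := hproj y hy
  rw [norm_sub_rev] at h4
  linarith

end Chaining

/-! ### Convergence and bounds for a fixed outcome -/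

section Pathwise

variable {Ω : Type*} {d : ℕ} {lo hi : Fin d → ℝ} {ρ : Space d → Space d → ℝ}
  {W : ℕ → Ω → box lo hi → ℂ} {g : ℕ → Ω → ℂ}

lemma one_half_le_log (N : ℕ) : 1 / 2 ≤ Real.log ((N : ℝ) + 2) := by
  have h1 : Real.log 2 ≤ Real.log ((N : ℝ) + 2) :=
    Real.log_le_log (by norm_num) (by linarith [Nat.cast_nonneg (α := ℝ) N])
  linarith [Real.log_two_gt_d9]

lemma Converges.tendsto_rest {ω : Ω} {x : box lo hi} (h : Converges W g ω x) (N : ℕ) :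
    Tendsto (fun k => partialSum W g (N + k) ω x - partialSum W g N ω x) atTop
      (𝓝 (rest W g N ω x)) := by
  obtain ⟨l, hl⟩ := h
  have h1 := hl.comp (tendsto_add_atTop_nat N)
  simp only [Function.comp_def, add_comm _ N] at h1
  rw [rest, limitField, hl.limUnder_eq]
  exact h1.sub_const _

lemma LocallyHolderComparable.exists_radius (hρ : LocallyHolderComparable ρ) {ε : ℝ}
    (hε : 0 < ε) :
    ∃ r : ℝ, 0 < r ∧ ∀ x₀ x y : Space d, ‖x - x₀‖ ≤ r → ‖y - x₀‖ ≤ r → ρ x y ≤ ε := by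
  obtain ⟨H, _, _, c, hH, _, _, _, hc, hcomp⟩ := hρ
  set t := min 1 ((ε / c) ^ H⁻¹) with ht
  have ht0 : 0 < t := lt_min one_pos (by positivity)
  refine ⟨t / 2, by positivity, fun x₀ x y hx hy => ?_⟩
  have hxy : ‖x - y‖ ≤ t := by
    have := norm_sub_le_norm_sub_add_norm_sub x x₀ y
    rw [norm_sub_rev x₀ y] at this
    linarith
  refine (hcomp x y (hxy.trans (min_le_left _ _))).2.trans ?_
  calc c * ‖x - y‖ ^ H ≤ c * ((ε / c) ^ H⁻¹) ^ H :=
        mul_le_mul_of_nonneg_left (Real.rpow_le_rpow (norm_nonneg _)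
          (hxy.trans (min_le_right _ _)) hH.le) hc.le
    _ = ε := by
        rw [← Real.rpow_mul (by positivity), inv_mul_cancel₀ hH.ne', Real.rpow_one]
        field_simp

/-- For a fixed outcome: the bound for the increments between net points, the convergence at the
net points and the tail bound give convergence and the bounds for the rests near `x₀`. -/
lemma exists_rest_bound (S : ScaleNet lo hi ρ) (hρ : IsQuasiMetric ρ)
    (hρ' : LocallyHolderComparable ρ) {ω : Ω} (hcont : ∀ n, Continuous (W n ω))
    (hconv : ∀ i, Converges W g ω (S.pt i)) {A : ℕ}
    (hA : ∀ p q N k,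
      ‖(partialSum W g (N + k) ω (S.pt p) - partialSum W g N ω (S.pt p)) -
        (partialSum W g (N + k) ω (S.pt q) - partialSum W g N ω (S.pt q))‖ₑ ≤
        ENNReal.ofReal (A * √(S.weight p + S.weight q + Real.log ((N : ℝ) + 2))) *
          tailParam W N ω (S.pt p) (S.pt q))
    (x₀ : box lo hi) {γ β η : ℝ} {b : ℕ → ℝ} (hγ : 0 < γ) (hβ : 0 < β) (hb : ∀ N, 0 < b N)
    (htail : ∀ N, ∀ x y : box lo hi,
      ‖(x : Space d) - x₀‖ ≤ γ → ‖(y : Space d) - x₀‖ ≤ γ →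
        tailParam W N ω x y ≤ ENNReal.ofReal (b N) * logModulus β η (ρ x y)) :
    ∃ γ' C : ℝ, 0 < γ' ∧ γ' < γ ∧ 0 < C ∧
      (∀ x : box lo hi, ‖(x : Space d) - x₀‖ ≤ γ' → Converges W g ω x) ∧
      ∀ N : ℕ, ∀ x y : box lo hi,
        ‖(x : Space d) - x₀‖ ≤ γ' → ‖(y : Space d) - x₀‖ ≤ γ' →
          ‖rest W g N ω x - rest W g N ω y‖ₑ ≤
            ENNReal.ofReal (C * b N * √(Real.log ((N : ℝ) + 2))) *
              logModulus β (η + 1 / 2) (ρ x y) ∧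
          ‖rest W g N ω x - rest W g N ω y‖ ≤ C * b N * √(Real.log ((N : ℝ) + 2)) := by
  obtain ⟨m, C, hm, hC, hchain⟩ := exists_chaining S hρ hγ hβ η
  obtain ⟨C₁, hC₁, H₁⟩ := exists_le_logModulus hβ (η + 1 / 2)
  -- Within this radius `ρ ≤ exp (-m) < 1`, so the singular value `h = 1` of the modulus is avoided.
  obtain ⟨r, hr, hrρ⟩ := hρ'.exists_radius (Real.exp_pos (-(m : ℝ)))
  have hm1 : (1 : ℝ) ≤ m := by exact_mod_cast hm
  set E := expModulus β (η + 1 / 2) m with hE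
  have hE0 : 0 ≤ E := expModulus_nonneg _ _ (by linarith)
  have hScont : ∀ N, Continuous fun x => partialSum W g N ω x := fun N => by
    unfold partialSum
    exact continuous_finsetSum _ fun n _ => (hcont n).mul continuous_const
  have hnet : ∀ N k, NetIncrementBound S x₀ γ β η (A * b N) (Real.log ((N : ℝ) + 2))
      (fun x => partialSum W g (N + k) ω x - partialSum W g N ω x) := by
    intro N k p q hp hq
    refine (hA p q N k).trans ((mul_le_mul' le_rfl (htail N _ _ hp hq)).trans (le_of_eq ?_))
    rw [ENNReal.ofReal_mul (Nat.cast_nonneg A), ENNReal.ofReal_mul (Nat.cast_nonneg A)]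
    ring
  have hchain' := fun N k => hchain x₀ (A * b N) (Real.log ((N : ℝ) + 2)) _
    ((hScont (N + k)).sub (hScont N)) (mul_nonneg (Nat.cast_nonneg A) (hb N).le)
    (one_half_le_log N) (hnet N k)
  -- Chaining from `N = 0` approximates the partial sums at `x` by those at one net point, uniformly
  -- in their length, so the Cauchy property carries over.
  have hconv' : ∀ x : box lo hi, ‖(x : Space d) - x₀‖ ≤ γ / 2 → Converges W g ω x := by
    intro x hx
    refine cauchySeq_tendsto_of_complete (Metric.cauchySeq_iff'.mpr fun ε hε => ?_)
    have hlim := (tendsto_expModulus hβ (η + 1 / 2)).const_mul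
      (C * (A * b 0 * √(Real.log (((0 : ℕ) : ℝ) + 2))))
    rw [mul_zero] at hlim
    obtain ⟨n, hnε, hn⟩ := ((hlim.eventually (gt_mem_nhds (by linarith : 0 < ε / 3))).and
      (eventually_ge_atTop m)).exists
    set p := S.proj n x
    have hclose : ∀ k, ‖partialSum W g k ω x - partialSum W g k ω (S.pt p)‖ < ε / 3 := by
      intro k
      have := (hchain' 0 k n hn x hx).1
      simp only [Pi.sub_apply, zero_add, partialSum, Finset.range_zero, Finset.sum_empty,
        sub_zero] at this
      exact this.trans_lt hnε
    obtain ⟨l, hl⟩ := hconv p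
    obtain ⟨N, hN⟩ := Metric.cauchySeq_iff'.mp hl.cauchySeq (ε / 3) (by linarith)
    refine ⟨N, fun k hk => ?_⟩
    have h1 := hclose k
    have h2 := hN k hk
    have h3 := hclose N
    rw [← dist_eq_norm] at h1 h3
    rw [dist_comm] at h3
    linarith [dist_triangle4 (partialSum W g k ω x) (partialSum W g k ω (S.pt p))
      (partialSum W g N ω (S.pt p)) (partialSum W g N ω x)]
  have hrest : ∀ N n : ℕ, m ≤ n → ∀ x y : box lo hi, ‖(x : Space d) - x₀‖ ≤ γ / 2 →
      ‖(y : Space d) - x₀‖ ≤ γ / 2 → ρ x y ≤ Real.exp (-n) →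
        ‖rest W g N ω x - rest W g N ω y‖ ≤
          C * (A * b N * √(Real.log ((N : ℝ) + 2))) * expModulus β (η + 1 / 2) n := by
    intro N n hn x y hx hy hxy
    refine le_of_tendsto' (((hconv' x hx).tendsto_rest N).sub ((hconv' y hy).tendsto_rest N)).norm
      fun k => (hchain' N k n hn x hx).2 y hy hxy
  -- `C₁` serves the bound with the modulus, `E` the one without it; `+ 1` keeps the constant
  -- positive when `A = 0`.
  have hC' : 0 < C * A * (C₁ + E) + 1 := by positivity
  refine ⟨min (γ / 2) r, C * A * (C₁ + E) + 1, lt_min (by linarith) hr,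
    (min_le_left _ _).trans_lt (by linarith), hC',
    fun x hx => hconv' x (hx.trans (min_le_left _ _)), fun N x y hx hy => ⟨?_, ?_⟩⟩
  · have hρm := hrρ x₀ x y (hx.trans (min_le_right _ _)) (hy.trans (min_le_right _ _))
    rcases (hρ.nonneg x y).eq_or_lt with h0 | h0
    · have hxy : x = y := Subtype.ext ((hρ.faithful _ _).mp h0.symm)
      simp [hxy]
    have hlogm : (m : ℝ) ≤ -Real.log (ρ x y) := by
      have := Real.log_le_log h0 hρm
      rw [Real.log_exp] at this
      linarith
    -- The scale with `exp (-(n + 1)) ≤ ρ x y ≤ exp (-n)`, on which the bound at level `n` and the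
    -- modulus are comparable.
    set n := ⌊-Real.log (ρ x y)⌋₊ with hn
    have hmn : m ≤ n := Nat.le_floor hlogm
    have hn1 : (1 : ℝ) ≤ n := by exact_mod_cast hm.trans hmn
    have hle : ρ x y ≤ Real.exp (-n) := by
      rw [← Real.log_le_iff_le_exp h0]
      linarith [Nat.floor_le (by linarith : 0 ≤ -Real.log (ρ x y))]
    have hge : Real.exp (-((n : ℝ) + 1)) ≤ ρ x y := by
      rw [← Real.le_log_iff_exp_le h0]
      linarith [Nat.lt_floor_add_one (-Real.log (ρ x y))]
    have hbN := hb N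
    rw [← ofReal_norm]
    calc ENNReal.ofReal ‖rest W g N ω x - rest W g N ω y‖
        ≤ ENNReal.ofReal (C * (A * b N * √(Real.log ((N : ℝ) + 2)))) *
            ENNReal.ofReal (expModulus β (η + 1 / 2) n) := by
          rw [← ENNReal.ofReal_mul (by positivity)]
          exact ENNReal.ofReal_le_ofReal (hrest N n hmn x y (hx.trans (min_le_left _ _))
            (hy.trans (min_le_left _ _)) hle)
      _ ≤ ENNReal.ofReal (C * (A * b N * √(Real.log ((N : ℝ) + 2)))) *
            (ENNReal.ofReal C₁ * logModulus β (η + 1 / 2) (ρ x y)) :=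
          mul_le_mul' le_rfl (H₁ n _ hn1 hle hge)
      _ ≤ _ := by
          rw [← mul_assoc, ← ENNReal.ofReal_mul (by positivity)]
          refine mul_le_mul' (ENNReal.ofReal_le_ofReal ?_) le_rfl
          have h1 : 0 ≤ b N * √(Real.log ((N : ℝ) + 2)) := by positivity
          have h2 : 0 ≤ C * A * E := by positivity
          nlinarith [mul_nonneg h2 h1]
  · have hρm := hrρ x₀ x y (hx.trans (min_le_right _ _)) (hy.trans (min_le_right _ _))
    refine (hrest N m le_rfl x y (hx.trans (min_le_left _ _)) (hy.trans (min_le_left _ _))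
      hρm).trans ?_
    have hbN := hb N
    have h1 : 0 ≤ b N * √(Real.log ((N : ℝ) + 2)) := by positivity
    have h2 : 0 ≤ C * A * C₁ := by positivity
    rw [← hE]
    nlinarith [mul_nonneg h2 h1]

end Pathwise

end CondSubGaussian

/-! ### The theorem -/

open CondSubGaussian in
theorem theorem3p3 {Ω : Type*} [MeasurableSpace Ω] (P : Measure Ω) [IsProbabilityMeasure P]
    {d : ℕ} (hd : 1 ≤ d) (lo hi : Fin d → ℝ)
    (W : ℕ → Ω → box lo hi → ℂ) (g : ℕ → Ω → ℂ)
    (hWg : IsCondSubGaussianSeries P W g)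
    (x₀ : box lo hi) (ρ : Space d → Space d → ℝ)
    (hρ : IsQuasiMetric ρ) (hρ' : LocallyHolderComparable ρ)
    (γ β η : Ω → ℝ) (b : ℕ → Ω → ℝ)
    (hb : IsTailBound P W x₀ ρ γ β η b) :
    (∀ᵐ ω ∂P, ∃ γ' C : ℝ, 0 < γ' ∧ γ' < γ ω ∧ 0 < C ∧
      (∀ x : box lo hi, ‖(x : Space d) - x₀‖ ≤ γ' → Converges W g ω x) ∧
      ∀ N : ℕ, ∀ x y : box lo hi,
        ‖(x : Space d) - x₀‖ ≤ γ' → ‖(y : Space d) - x₀‖ ≤ γ' →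
          ‖rest W g N ω x - rest W g N ω y‖ₑ ≤
            ENNReal.ofReal (C * b N ω * √(Real.log ((N : ℝ) + 2))) *
              logModulus (β ω) (η ω + 1 / 2) (ρ x y)) ∧
    ((∀ᵐ ω ∂P, ∀ N : ℕ, ‖rest W g N ω x₀‖ ≤ b N ω * √(Real.log ((N : ℝ) + 2))) →
      ∀ᵐ ω ∂P, ∃ γ' C : ℝ, 0 < γ' ∧ γ' < γ ω ∧ 0 < C ∧
        (∀ x : box lo hi, ‖(x : Space d) - x₀‖ ≤ γ' → Converges W g ω x) ∧
        ∀ N : ℕ, ∀ x : box lo hi, ‖(x : Space d) - x₀‖ ≤ γ' →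
          ‖rest W g N ω x‖ ≤ C * b N ω * √(Real.log ((N : ℝ) + 2))) := by
  obtain ⟨S⟩ := nonempty_scaleNet x₀ hρ'
  have := S.countable
  have main : ∀ᵐ ω ∂P, ∃ γ' C : ℝ, 0 < γ' ∧ γ' < γ ω ∧ 0 < C ∧
      (∀ x : box lo hi, ‖(x : Space d) - x₀‖ ≤ γ' → Converges W g ω x) ∧
      ∀ N : ℕ, ∀ x y : box lo hi,
        ‖(x : Space d) - x₀‖ ≤ γ' → ‖(y : Space d) - x₀‖ ≤ γ' →
          ‖rest W g N ω x - rest W g N ω y‖ₑ ≤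
            ENNReal.ofReal (C * b N ω * √(Real.log ((N : ℝ) + 2))) *
              logModulus (β ω) (η ω + 1 / 2) (ρ x y) ∧
          ‖rest W g N ω x - rest W g N ω y‖ ≤ C * b N ω * √(Real.log ((N : ℝ) + 2)) := by
    filter_upwards [hWg.continuous_W, ae_all_iff.mpr fun i => hWg.ae_converges (S.pt i),
      hWg.ae_exists_forall_increment_le S.pt S.weight_nonneg S.summable_weight,
      hb.γ_pos, hb.β_mem, hb.b_pos, hb.bound] with ω hcont hconv hA hγ hβ hbpos htail
    obtain ⟨A, hA⟩ := hA
    exact exists_rest_bound S hρ hρ' hcont hconv hA x₀ hγ hβ.1 hbpos htail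
  constructor
  · filter_upwards [main] with ω ⟨γ', C, h1, h2, h3, h4, h5⟩
    exact ⟨γ', C, h1, h2, h3, h4, fun N x y hx hy => (h5 N x y hx hy).1⟩
  · intro hrest
    filter_upwards [main, hrest] with ω ⟨γ', C, h1, h2, h3, h4, h5⟩ h6
    -- The increment from `x₀` contributes `C`, and the assumed bound at `x₀` contributes `1`.
    refine ⟨γ', C + 1, h1, h2, by linarith, h4, fun N x hx => ?_⟩
    have h7 := (h5 N x x₀ hx (by simpa using h1.le)).2
    have h8 := norm_sub_norm_le (rest W g N ω x) (rest W g N ω x₀)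
    linarith [h6 N]
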